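/- Let $k,m,n$ be non-negative integers with $k\le\min(m,n)$. Take the complete bipartite graph with vertex sets $\{a_1,\dots,a_m\}$ and $\{b_1,\dots,b_n\}$, and add to the first set a ghost vertex $g$ joined to all of $b_1,\dots,b_n$. All edge costs are independent and exponentially distributed, with mean $1$ for the ordinary edges and with mean $1/h$ (where $h>0$) for the ghost edges, that is, the edges at $g$. A $k$-matching is a set of $k$ edges such that every vertex other than $g$ is in at most one of them (the ghost vertex may be in any number). Let $C_{k,m,n}$ be the minimum total cost of a $k$-matching, and let $I_{k,m,n}(d)$ be the indicator variable of the event that the optimal $k$-matching (almost surely unique) contains exactly $d$ ghost edges. For $d\ge 0$ and $t\in\mathbb C$ put \[ F^{(d)}_{k,m,n}(t)=\lim_{h\to 0^+}\frac1{h^d}\,\mathbb E\bigl[\exp(t\,C_{k,m,n})\cdot I_{k,m,n}(d)\bigr] \] wherever this converges, that is, where the expectation is absolutely convergent for all sufficiently small $h>0$ and the limit exists in $\mathbb C$. Then $F^{(d)}_{k,m,n}(t)$ converges for all $d\ge 0$ and all $t$ with $\operatorname{Re}(t)\le 0$. For all $t$ one has the base case $F^{(0)}_{0,m,n}(t)=1$,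 for arbitrary $m,n\ge 0$, and $F^{(d)}_{k,m,n}(t)=0$ if $d>k$. Moreover, for $1\le k\le\min(m,n)$ and for every $t\in\mathbb C$ at which the functions occurring in the equation converge, \[ F_{k,m,n}^{(0)}(t) = \frac{t}{n}\, F_{k,m,n}^{(1)}(t) +F_{k-1,m,n-1}^{(0)}(t), \] and for $d\ge 1$, \[ F_{k,m,n}^{(d)}(t) = \left(1 - \frac{d\,t}{(m-k+d)\,n}\right)^{-1} \left( \frac1{m-k+d}\, F_{k-1,m,n-1}^{(d-1)}(t) + \frac{d+1}{n}\, t\, F_{k,m,n}^{(d+1)}(t) +F_{k-1,m,n-1}^{(d)}(t) \right). \] Here, if $d\le k$, the number $1-\frac{dt}{(m-k+d)n}$ is nonzero at every such $t$; if $d>k$, all the functions in the last equation are zero, so that it holds trivially, with the convention $0^{-1}=0$. -/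

import Mathlib

open Filter MeasureTheory ProbabilityTheory
open scoped Topology

namespace GhostMatching

/-- The edges of the extended complete bipartite graph: on the left the `m` ordinary vertices
`some i` and the ghost vertex `none`, on the right `n` vertices. -/
abbrev Edge (m n : ℕ) : Type := Option (Fin m) × Fin n

/-- A matching of the extended graph: every right vertex and every ordinary left vertex is in at
most one edge; the ghost vertex may be in any number of edges. -/
def IsMatching {m n : ℕ} (M : Finset (Edge m n)) : Prop :=
  (∀ e ∈ M, ∀ f ∈ M, e.2 = f.2 → e = f) ∧
  (∀ e ∈ M, ∀ f ∈ M, e.1 ≠ none → e.1 = f.1 → e = f)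

/-- A `k`-matching is a matching with exactly `k` edges. -/
def IsKMatching {m n : ℕ} (k : ℕ) (M : Finset (Edge m n)) : Prop :=
  IsMatching M ∧ M.card = k

/-- The number of ghost edges in a set of edges. -/
def ghostCount {m n : ℕ} (M : Finset (Edge m n)) : ℕ :=
  (M.filter (fun e => e.1 = none)).card

/-- The total cost of a set of edges. -/
def cost {m n : ℕ} (c : Edge m n → ℝ) (M : Finset (Edge m n)) : ℝ :=
  ∑ e ∈ M, c e

/-- `M` is an optimal solution to the `k`-matching problem with edge costs `c`. -/
def IsOptimal {m n : ℕ} (k : ℕ) (c : Edge m n → ℝ) (M : Finset (Edge m n)) : Prop :=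
  IsKMatching k M ∧ ∀ M' : Finset (Edge m n), IsKMatching k M' → cost c M ≤ cost c M'

/-- The minimum cost of a `k`-matching of the extended graph with edge costs `c`.
(A minimum over a finite set, which is nonempty as soon as `k ≤ n`.) -/
noncomputable def minCost {m n : ℕ} (k : ℕ) (c : Edge m n → ℝ) : ℝ :=
  sInf {x : ℝ | ∃ M : Finset (Edge m n), IsKMatching k M ∧ x = cost c M}

/-- The event that exactly `d` ghost edges participate in the optimal `k`-matching. (The optimal
matching is almost surely unique for the random costs below.) -/
def ghostEvent (k m n d : ℕ) : Set (Edge m n → ℝ) :=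
  {c | ∃ M : Finset (Edge m n), IsOptimal k c M ∧ ghostCount M = d}

/-- The rate of the cost of an edge: `h` for ghost edges (mean `1 / h`), `1` for ordinary ones. -/
noncomputable def rate {m n : ℕ} (h : ℝ) (e : Edge m n) : ℝ :=
  if e.1 = none then h else 1

/-- The joint law of the independent exponential edge costs. -/
noncomputable def costLaw (m n : ℕ) (h : ℝ) : Measure (Edge m n → ℝ) :=
  Measure.pi (fun e : Edge m n => expMeasure (rate h e))

/-- The random variable `exp (t C) · I(d)`. -/
noncomputable def ghostVariable (k m n d : ℕ) (t : ℂ) : (Edge m n → ℝ) → ℂ :=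
  (ghostEvent k m n d).indicator (fun c => Complex.exp (t * (minCost k c : ℂ)))

/-- `h ^ (-d) * E[exp (t C) · I(d)]`, for ghost edges of rate `h`. -/
noncomputable def ghostQuotient (k m n d : ℕ) (t : ℂ) (h : ℝ) : ℂ :=
  1 / (h : ℂ) ^ d * ∫ c, ghostVariable k m n d t c ∂(costLaw m n h)

/-- The ghost generating function converges at `t`: the expectations converge absolutely for all
sufficiently small `h > 0`, and the limit as `h → 0` exists (as a complex number). -/
def Converges (k m n d : ℕ) (t : ℂ) : Prop :=
  (∀ᶠ h : ℝ in 𝓝[>] 0, Integrable (ghostVariable k m n d t) (costLaw m n h)) ∧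
  ∃ z : ℂ, Tendsto (ghostQuotient k m n d t) (𝓝[>] 0) (𝓝 z)

/-- The ghost generating function (meaningful where it converges). -/
noncomputable def ghostGF (k m n d : ℕ) (t : ℂ) : ℂ :=
  limUnder (𝓝[>] (0 : ℝ)) (ghostQuotient k m n d t)

end GhostMatching

namespace GhostMatching

/-! Fix a right vertex `b`. Compare the optimal `k`-matching `M`, of cost `C`, with the optimal
`(k-1)`-matching `M'` avoiding `b`, of cost `C'`. Almost surely both are unique. Switching along
alternating paths (`exchange`) shows that `M` covers every ordinary left vertex of `M'`, contains
every ghost edge of `M'`, and has exactly one further, "new" edge (`exists_new_edge`). So the number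
of ghost edges grows by `0` or `1`.

Given `M'`, a left vertex `a` that it does not use and a right vertex `j`, whether the new edge is
`(a, j)` or the ghost edge at `j` depends only on which of these two exponential costs is smaller;
everything else depends on the smaller value alone. Hence the two probabilities, jointly with the
value of `C`, are in the ratio `1 : h` (`measure_uses`). If `M'` has `d` ghost edges, there are
`m-k+d+1` unused left vertices, so the part of the expectation where `M` has `d` ghost edges is to
the part where it has `d+1` as `m-k+d+1` to `h` (`measure_jointEvent`).

Secondly, let `X` be the cost of the ghost edge at `b`. Then `C = C' + min X T`, where `C'` and `T ≥
0` do not depend on `X`, and integration by parts gives `E exp(t min(X,T)) = 1 + (t/h) E[exp(tX); X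
≤ T]`. The event `X ≤ T` means that the ghost edge at `b` is used; by symmetry between the right
vertices it carries the fraction `(d+1)/n` of the expectation over `d+1` ghost edges. This computes
the expectation of `exp(tC)` over the event that `M'` has `d` ghost edges (`setIntegral_smallEvent`,
`setIntegral_ghostAt`).

Splitting these expectations in the ratio above and regrouping by the ghost edges of `M` gives an
exact recursion for every `h > 0` (`ghostQuotient_zero`, `ghostQuotient_succ`); the theorem is its
limit. The term for `d` occurs on both sides, and solving for it produces the inverse factor. For
`Re t ≤ 0` this factor has real part at least `1` before inversion, which yields convergence by
induction. In general, a zero of it would make a sum of nonnegative terms, one of them positive,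
vanish (`coeff_ne_zero_of_converges`). -/

/-- A matching avoiding the right vertices in `Z`, of size `k` when these are counted too. -/
def IsFeasible {m n : ℕ} (k : ℕ) (Z : Finset (Fin n)) (M : Finset (Edge m n)) : Prop :=
  IsMatching M ∧ (∀ e ∈ M, e.2 ∉ Z) ∧ M.card + Z.card = k

/-- A feasible matching of minimum cost. -/
def IsBest {m n : ℕ} (k : ℕ) (Z : Finset (Fin n)) (c : Edge m n → ℝ)
    (M : Finset (Edge m n)) : Prop :=
  IsFeasible k Z M ∧ ∀ M', IsFeasible k Z M' → cost c M ≤ cost c M'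

theorem isFeasible_empty_iff {m n k : ℕ} {M : Finset (Edge m n)} :
    IsFeasible k ∅ M ↔ IsKMatching k M := by
  simp [IsFeasible, IsKMatching]

theorem isBest_empty_iff {m n k : ℕ} {c : Edge m n → ℝ} {M : Finset (Edge m n)} :
    IsBest k ∅ c M ↔ IsOptimal k c M := by
  simp [IsBest, IsOptimal, isFeasible_empty_iff]

/-! ### Labellings of the right vertices and alternating paths. -/

/-- The labels of right vertices: a left vertex, or one of `r` dummies, or the label of the
forbidden vertices. -/
abbrev Label (m r : ℕ) : Type := Option (Fin m) ⊕ Option (Fin r)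

/-- The edges described by a labelling of the right vertices. -/
def edges {m n r : ℕ} (f : Fin n → Label m r) : Finset (Edge m n) :=
  Finset.univ.filter fun e => f e.2 = Sum.inl e.1

theorem mem_edges {m n r : ℕ} {f : Fin n → Label m r} {e : Edge m n} :
    e ∈ edges f ↔ f e.2 = Sum.inl e.1 := by
  simp [edges]

/-- Labels that may occur only once. -/
def IsProper {m r : ℕ} (l : Label m r) : Prop := l ≠ Sum.inl none ∧ l ≠ Sum.inr none

/-- A labelling in which exactly the vertices of `Z` are forbidden and every dummy is used. -/
structure IsLabelling {m n r : ℕ} (Z : Finset (Fin n)) (f : Fin n → Label m r) : Prop where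
  inj : ∀ i j, f i = f j → IsProper (f i) → i = j
  forbidden : ∀ j, f j = Sum.inr none ↔ j ∈ Z
  dummy : ∀ s, ∃ j, f j = Sum.inr (some s)

theorem cost_edges {m n r : ℕ} (c : Edge m n → ℝ) (f : Fin n → Label m r) :
    cost c (edges f) = ∑ j, Sum.elim (fun x => c (x, j)) (fun _ => 0) (f j) := by
  rw [cost, edges, Finset.sum_filter, Fintype.sum_prod_type_right]
  refine Finset.sum_congr rfl fun j _ => ?_
  rcases hf : f j with x | y
  · simp only [hf, Sum.inl.injEq, Sum.elim_inl]
    rw [Finset.sum_eq_single x (fun y _ hy => if_neg hy.symm) (by simp), if_pos rfl]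
  · simp [hf, -Fintype.sum_option]

theorem card_edges {m n r : ℕ} {Z : Finset (Fin n)} {f : Fin n → Label m r}
    (hf : IsLabelling Z f) : (edges f).card + Z.card + r = n := by
  classical
  choose g hg using hf.dummy
  have ginj : Function.Injective g := fun s t h => by
    have := hg s
    rw [h, hg t] at this
    simpa using this.symm
  have h1 : ((edges f).image Prod.snd).card = (edges f).card := by
    refine Finset.card_image_of_injOn fun e he e' he' h => ?_
    have he := mem_edges.1 (Finset.mem_coe.1 he)
    have he' := mem_edges.1 (Finset.mem_coe.1 he')
    have h : e.2 = e'.2 := h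
    rw [h, he'] at he
    exact Prod.ext (by simpa using he.symm) h
  have h2 : (Finset.univ.image g).card = r := by
    rw [Finset.card_image_of_injective _ ginj, Finset.card_univ, Fintype.card_fin]
  have d1 : Disjoint ((edges f).image Prod.snd) Z := by
    rw [Finset.disjoint_left]
    intro j hj hZ
    obtain ⟨e, he, rfl⟩ := Finset.mem_image.1 hj
    rw [← hf.forbidden, mem_edges.1 he] at hZ
    simp at hZ
  have d2 : Disjoint ((edges f).image Prod.snd ∪ Z) (Finset.univ.image g) := by
    rw [Finset.disjoint_left]
    intro j hj hj'
    obtain ⟨s, -, rfl⟩ := Finset.mem_image.1 hj'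
    rcases Finset.mem_union.1 hj with h | h
    · obtain ⟨e, he, he'⟩ := Finset.mem_image.1 h
      have := mem_edges.1 he
      rw [he', hg] at this
      simp at this
    · rw [← hf.forbidden, hg] at h
      simp at h
  have hu : ((edges f).image Prod.snd ∪ Z) ∪ Finset.univ.image g = Finset.univ := by
    refine Finset.eq_univ_of_forall fun j => ?_
    rcases hj : f j with x | (_ | s)
    · exact Finset.mem_union_left _ (Finset.mem_union_left _
        (Finset.mem_image.2 ⟨(x, j), mem_edges.2 hj, rfl⟩))
    · exact Finset.mem_union_left _ (Finset.mem_union_right _ ((hf.forbidden j).1 hj))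
    · refine Finset.mem_union_right _ (Finset.mem_image.2 ⟨s, Finset.mem_univ _, ?_⟩)
      exact hf.inj _ _ ((hg s).trans hj.symm) (by rw [hg]; simp [IsProper])
  have := congrArg Finset.card hu
  rw [Finset.card_union_of_disjoint d2, Finset.card_union_of_disjoint d1, h1, h2,
    Finset.card_univ, Fintype.card_fin] at this
  exact this

theorem IsLabelling.isFeasible {m n k : ℕ} (hk : k ≤ n) {Z : Finset (Fin n)}
    {f : Fin n → Label m (n - k)} (hf : IsLabelling Z f) : IsFeasible k Z (edges f) := by
  refine ⟨⟨fun e he e' he' h => ?_, fun e he e' he' h0 h => ?_⟩, fun e he hZ => ?_, ?_⟩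
  · have he := mem_edges.1 he
    rw [h, mem_edges.1 he'] at he
    exact Prod.ext (by simpa using he.symm) h
  · have he := mem_edges.1 he
    have he' := mem_edges.1 he'
    refine Prod.ext h (hf.inj _ _ (by rw [he, he', h]) ?_)
    rw [he]
    simpa [IsProper] using h0
  · rw [← hf.forbidden, mem_edges.1 he] at hZ
    simp at hZ
  · have := card_edges hf
    omega

/-- Since `Z` is counted in `k`, exactly `n - k` right vertices outside `Z` are unmatched, whatever
`Z` is. Numbering them by dummies puts matchings with different forbidden sets on an equal footing,
so that they can be exchanged as labellings. -/
theorem IsFeasible.exists_labelling {m n k : ℕ} {Z : Finset (Fin n)}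
    {M : Finset (Edge m n)} (hM : IsFeasible k Z M) :
    ∃ f : Fin n → Label m (n - k), IsLabelling Z f ∧ edges f = M := by
  classical
  obtain ⟨⟨h1, h2⟩, h3, h4⟩ := hM
  have hinj : Set.InjOn Prod.snd (M : Set (Edge m n)) := fun e he e' he' h => h1 e he e' he' h
  have d : Disjoint (M.image Prod.snd) Z := by
    rw [Finset.disjoint_left]
    intro j hj
    obtain ⟨e, he, rfl⟩ := Finset.mem_image.1 hj
    exact h3 e he
  have hcard : (M.image Prod.snd ∪ Z)ᶜ.card = n - k := by
    rw [Finset.card_compl, Finset.card_union_of_disjoint d, Finset.card_image_of_injOn hinj, h4,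
      Fintype.card_fin]
  let σ := Finset.equivFinOfCardEq hcard
  let f : Fin n → Label m (n - k) := fun j =>
    if h : ∃ x, (x, j) ∈ M then Sum.inl h.choose
    else if h' : j ∈ (M.image Prod.snd ∪ Z)ᶜ then Sum.inr (some (σ ⟨j, h'⟩)) else Sum.inr none
  have fl : ∀ j x, f j = Sum.inl x ↔ (x, j) ∈ M := by
    intro j x
    by_cases h : ∃ x, (x, j) ∈ M
    · simp only [f, dif_pos h, Sum.inl.injEq]
      constructor
      · rintro rfl
        exact h.choose_spec
      · intro hx
        simpa using h1 _ h.choose_spec _ hx rfl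
    · have : (x, j) ∉ M := fun hx => h ⟨x, hx⟩
      simp only [f, dif_neg h, this, iff_false]
      split_ifs <;> simp
  have fd : ∀ j s, f j = Sum.inr (some s) → ∃ h', σ ⟨j, h'⟩ = s := by
    intro j s hj
    by_cases h : ∃ x, (x, j) ∈ M
    · simp [f, dif_pos h] at hj
    · simp only [f, dif_neg h] at hj
      split_ifs at hj with h'
      · exact ⟨h', by simpa using hj⟩
      · simp at hj
  refine ⟨f, ⟨fun i j h hp => ?_, fun j => ?_, fun s => ?_⟩, ?_⟩
  · rcases hi : f i with x | (_ | s)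
    · have hi' := (fl _ _).1 hi
      have hj' := (fl _ _).1 (h.symm.trans hi)
      have hx : x ≠ none := fun h0 => hp.1 (by rw [hi, h0])
      exact congrArg Prod.snd (h2 _ hi' _ hj' hx rfl)
    · exact absurd hi hp.2
    · obtain ⟨a, ha⟩ := fd _ _ hi
      obtain ⟨a', ha'⟩ := fd _ _ (h.symm.trans hi)
      have := σ.injective (ha.trans ha'.symm)
      simpa using this
  · constructor
    · intro hj
      by_cases h : ∃ x, (x, j) ∈ M
      · simp [f, dif_pos h] at hj
      · simp only [f, dif_neg h] at hj
        have h' : j ∈ M.image Prod.snd ∪ Z := by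
          by_contra h'
          rw [dif_pos (Finset.mem_compl.2 h')] at hj
          simp at hj
        rw [Finset.mem_union] at h'
        rcases h' with h' | h'
        · obtain ⟨e, he, rfl⟩ := Finset.mem_image.1 h'
          exact absurd ⟨e.1, he⟩ h
        · exact h'
    · intro hj
      have h : ¬ ∃ x, (x, j) ∈ M := fun ⟨x, hx⟩ => h3 _ hx hj
      simp only [f, dif_neg h]
      rw [dif_neg]
      simp [hj]
  · refine ⟨(σ.symm s).1, ?_⟩
    have hs := (σ.symm s).2
    have h : ¬ ∃ x, (x, (σ.symm s).1) ∈ M := by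
      rintro ⟨x, hx⟩
      rw [Finset.mem_compl, Finset.mem_union, not_or] at hs
      exact hs.1 (Finset.mem_image.2 ⟨_, hx, rfl⟩)
    simp only [f, dif_neg h]
    rw [dif_pos hs]
    simp
  · ext e
    rw [mem_edges, fl]

/-- Exchanging two labellings on a set closed under equality of proper labels. -/
theorem IsLabelling.piecewise {m n r : ℕ} {Z Z' : Finset (Fin n)} {b : Fin n}
    (hZ : Z ⊆ {b}) (hZ' : Z' ⊆ {b})
    {f f' : Fin n → Label m r} (hf : IsLabelling Z f) (hf' : IsLabelling Z' f') (K : Set (Fin n))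
    [DecidablePred (· ∈ K)]
    (hK : ∀ i j, f i = f' j → IsProper (f i) → (i ∈ K ↔ j ∈ K)) :
    IsLabelling (if b ∈ K then Z' else Z) (fun j => if j ∈ K then f' j else f j) := by
  refine ⟨fun i j h hp => ?_, fun j => ?_, fun s => ?_⟩
  · by_cases hi : i ∈ K <;> by_cases hj : j ∈ K <;> simp only [hi, hj, if_true, if_false] at h hp
    · exact hf'.inj _ _ h hp
    · exact absurd ((hK j i h.symm (h ▸ hp)).2 hi) hj
    · exact absurd ((hK i j h hp).2 hj) hi
    · exact hf.inj _ _ h hp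
  · by_cases hjb : j = b
    · subst hjb
      split_ifs
      · exact hf'.forbidden _
      · exact hf.forbidden _
    · have hjZ : j ∉ Z := fun h => hjb (Finset.mem_singleton.1 (hZ h))
      have hjZ' : j ∉ Z' := fun h => hjb (Finset.mem_singleton.1 (hZ' h))
      have h1 := hf'.forbidden j
      have h2 := hf.forbidden j
      split_ifs <;> simp_all
  · obtain ⟨i, hi⟩ := hf.dummy s
    obtain ⟨j, hj⟩ := hf'.dummy s
    have := hK i j (hi.trans hj.symm) (by rw [hi]; simp [IsProper])
    by_cases h : j ∈ K
    · exact ⟨j, by simp [h, hj]⟩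
    · exact ⟨i, by simp [this, h, hi]⟩

/-- Switching labels along the alternating path from `j₀` only redistributes the edges of `P` and
`Q`, so the total cost is conserved for every cost function. If the path passes through `b`, the
forbidden sets are exchanged as well, which can happen only for `Z' = ∅`. The ghost label may be
repeated, so no path enters another ghost edge of `Q`. -/
theorem exchange {m n k : ℕ} (hk : k ≤ n) {Z Z' : Finset (Fin n)} {b : Fin n}
    (hZ : Z ⊆ {b}) (hZ' : Z' ⊆ {b}) {P Q : Finset (Edge m n)}
    (hP : IsFeasible k Z P) (hQ : IsFeasible k Z' Q) {x : Option (Fin m)} {j₀ : Fin n}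
    (he : (x, j₀) ∈ Q) (hx : x = none ∨ ∀ j, (x, j) ∉ P) :
    ∃ P₂ Q₂ : Finset (Edge m n),
      ((IsFeasible k Z P₂ ∧ IsFeasible k Z' Q₂) ∨
        (Z' = ∅ ∧ IsFeasible k Z' P₂ ∧ IsFeasible k Z Q₂)) ∧
      (∀ c, cost c P₂ + cost c Q₂ = cost c P + cost c Q) ∧
      (x, j₀) ∈ P₂ ∧ (x ≠ none → ∀ j, (x, j) ∉ Q₂) ∧
      ∀ j, j ≠ j₀ → (none, j) ∈ Q → (none, j) ∈ Q₂ := by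
  classical
  obtain ⟨f, hf, rfl⟩ := hP.exists_labelling
  obtain ⟨f', hf', rfl⟩ := hQ.exists_labelling
  -- `R i j` says that `Q` gives to `j` the label that `P` gives to `i`, so `j` must be switched
  -- once `i` is. A label that is not proper, such as that of a ghost edge, ends the path.
  let R : Fin n → Fin n → Prop := fun i j => f i = f' j ∧ IsProper (f i)
  let K : Set (Fin n) := {j | Relation.ReflTransGen R j₀ j}
  have hj₀ : j₀ ∈ K := Relation.ReflTransGen.refl
  have hpre : ∀ j ∈ K, j = j₀ ∨ ∃ i ∈ K, R i j := by
    intro j hj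
    rcases Relation.ReflTransGen.cases_tail hj with h | ⟨i, hi, hij⟩
    · exact Or.inl h
    · exact Or.inr ⟨i, hi, hij⟩
  have he' : f' j₀ = Sum.inl x := mem_edges.1 he
  -- The path has no vertex before `j₀`: the label `x` is either repeatable or absent from `P`. This
  -- makes `K` closed backwards too.
  have hno : ∀ i, ¬ R i j₀ := by
    rintro i ⟨h1, h2⟩
    rw [h1, he'] at h2
    rcases hx with hx | hx
    · exact h2.1 (by rw [hx])
    · exact hx i (mem_edges.2 (h1.trans he'))
  have hK : ∀ i j, f i = f' j → IsProper (f i) → (i ∈ K ↔ j ∈ K) := by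
    intro i j h hp
    refine ⟨fun hi => Relation.ReflTransGen.tail hi ⟨h, hp⟩, fun hj => ?_⟩
    rcases hpre j hj with rfl | ⟨i', hi', h', hp'⟩
    · exact absurd ⟨h, hp⟩ (hno i)
    · rwa [hf.inj i i' (h.trans h'.symm) hp]
  have hK' : ∀ i j, f' i = f j → IsProper (f' i) → (i ∈ K ↔ j ∈ K) := fun i j h hp =>
    (hK j i h.symm (h ▸ hp)).symm
  have L := hf.piecewise hZ hZ' hf' K hK
  have L' := hf'.piecewise hZ' hZ hf K hK'
  refine ⟨edges fun j => if j ∈ K then f' j else f j,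
    edges fun j => if j ∈ K then f j else f' j, ?_, fun c => ?_, ?_, ?_, ?_⟩
  -- If `Z' = {b}`, then `f' b` is the forbidden label, which is not proper, so the path cannot
  -- reach `b`.
  · by_cases hb : b ∈ K
    · simp only [hb, if_true] at L L'
      refine Or.inr ⟨?_, L.isFeasible hk, L'.isFeasible hk⟩
      rcases Finset.subset_singleton_iff.1 hZ' with h | h
      · exact h
      · exfalso
        have hbf : f' b = Sum.inr none := (hf'.forbidden b).2 (by simp [h])
        rcases hpre b hb with rfl | ⟨i, -, h1, h2⟩
        · rw [he'] at hbf
          simp at hbf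
        · exact h2.2 (h1.trans hbf)
    · simp only [hb, if_false] at L L'
      exact Or.inl ⟨L.isFeasible hk, L'.isFeasible hk⟩
  · simp only [cost_edges, ← Finset.sum_add_distrib]
    refine Finset.sum_congr rfl fun j _ => ?_
    split_ifs
    · rw [add_comm]
    · rfl
  · simp [mem_edges, hj₀, he']
  · intro hx0 j hj
    have hx := hx.resolve_left hx0
    have hj := mem_edges.1 hj
    by_cases h : j ∈ K
    · simp only [h, if_true] at hj
      exact hx j (mem_edges.2 hj)
    · simp only [h, if_false] at hj
      refine h (hf'.inj j j₀ (hj.trans he'.symm) ?_ ▸ hj₀)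
      rw [hj]
      simpa [IsProper] using hx0
  · intro j hj hQ
    have hQ := mem_edges.1 hQ
    have h : j ∉ K := by
      intro h
      rcases hpre j h with h | ⟨i, -, h1, h2⟩
      · exact hj h
      · exact h2.1 (h1.trans hQ)
    simp [mem_edges, h, hQ]

/-! ### Optimal matchings with and without the right vertex `b`. -/

variable {m n k : ℕ}

theorem cost_update_of_notMem {c : Edge m n → ℝ} {M : Finset (Edge m n)} {e : Edge m n}
    (he : e ∉ M) (v : ℝ) : cost (Function.update c e v) M = cost c M :=
  Finset.sum_congr rfl fun f hf => by
    rw [Function.update_of_ne]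
    rintro rfl
    exact he hf

theorem cost_update_of_mem {c : Edge m n → ℝ} {M : Finset (Edge m n)} {e : Edge m n}
    (he : e ∈ M) (v : ℝ) : cost (Function.update c e v) M = cost c M - c e + v := by
  unfold cost
  rw [← Finset.add_sum_erase _ _ he, ← Finset.add_sum_erase _ c he, Function.update_self]
  have : ∑ x ∈ M.erase e, Function.update c e v x = ∑ x ∈ M.erase e, c x :=
    cost_update_of_notMem (Finset.notMem_erase e M) v
  rw [this]
  ring

theorem IsBest.cost_eq {c : Edge m n → ℝ} {Z : Finset (Fin n)} {M N : Finset (Edge m n)}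
    (hM : IsBest k Z c M) (hN : IsBest k Z c N) : cost c M = cost c N :=
  le_antisymm (hM.2 _ hN.1) (hN.2 _ hM.1)

theorem IsBest.of_cost_le {c : Edge m n → ℝ} {Z : Finset (Fin n)} {M N : Finset (Edge m n)}
    (hM : IsBest k Z c M) (hN : IsFeasible k Z N) (h : cost c N ≤ cost c M) : IsBest k Z c N :=
  ⟨hN, fun _ hL => h.trans (hM.2 _ hL)⟩

/-- An unused edge may become more expensive. -/
theorem IsBest.raise {c : Edge m n → ℝ} {Z : Finset (Fin n)} {M : Finset (Edge m n)}
    (hM : IsBest k Z c M) {e : Edge m n} (he : e ∉ M) {v : ℝ} (hv : c e ≤ v) :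
    IsBest k Z (Function.update c e v) M := by
  refine ⟨hM.1, fun N hN => ?_⟩
  rw [cost_update_of_notMem he]
  refine (hM.2 N hN).trans ?_
  by_cases h : e ∈ N
  · rw [cost_update_of_mem h]
    linarith
  · rw [cost_update_of_notMem h]

/-- Replacing the left end of an edge of a matching by a free left vertex. -/
theorem IsFeasible.replace {Z : Finset (Fin n)} {M : Finset (Edge m n)} (hM : IsFeasible k Z M)
    {x y : Option (Fin m)} {j : Fin n} (hx : (x, j) ∈ M) (hy : y = none ∨ ∀ i, (y, i) ∉ M)
    (hxy : x ≠ y) :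
    IsFeasible k Z (insert (y, j) (M.erase (x, j))) ∧
      ∀ c, cost c (insert (y, j) (M.erase (x, j))) = cost c M - c (x, j) + c (y, j) := by
  obtain ⟨⟨h1, h2⟩, h3, h4⟩ := hM
  have hyj : (y, j) ∉ M := fun h => hxy (congrArg Prod.fst (h1 _ hx _ h rfl))
  have hyj' : (y, j) ∉ M.erase (x, j) := fun h => hyj (Finset.mem_of_mem_erase h)
  have hj : ∀ e ∈ M.erase (x, j), e.2 ≠ j := fun e he h =>
    (Finset.mem_erase.1 he).1 (h1 _ (Finset.mem_erase.1 he).2 _ hx h)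
  have hl : y ≠ none → ∀ e ∈ M.erase (x, j), e.1 ≠ y := by
    rintro h e he rfl
    exact hy.resolve_left h e.2 (Finset.mem_of_mem_erase he)
  refine ⟨⟨⟨?_, ?_⟩, ?_, ?_⟩, fun c => ?_⟩
  · intro e he f hf h
    rcases Finset.mem_insert.1 he with rfl | he <;> rcases Finset.mem_insert.1 hf with rfl | hf
    · rfl
    · exact absurd h.symm (hj f hf)
    · exact absurd h (hj e he)
    · exact h1 e (Finset.mem_of_mem_erase he) f (Finset.mem_of_mem_erase hf) h
  · intro e he f hf h0 h
    rcases Finset.mem_insert.1 he with rfl | he <;> rcases Finset.mem_insert.1 hf with rfl | hf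
    · rfl
    · exact absurd h.symm (hl h0 f hf)
    · exact absurd h (hl (fun h' => h0 (h.trans h')) e he)
    · exact h2 e (Finset.mem_of_mem_erase he) f (Finset.mem_of_mem_erase hf) h0 h
  · intro e he
    rcases Finset.mem_insert.1 he with rfl | he
    · exact h3 (x, j) hx
    · exact h3 e (Finset.mem_of_mem_erase he)
  · rw [Finset.card_insert_of_notMem hyj', Finset.card_erase_add_one hx, h4]
  · unfold cost
    rw [Finset.sum_insert hyj', ← Finset.add_sum_erase M c hx]
    ring

theorem IsFeasible.not_both {Z : Finset (Fin n)} {M : Finset (Edge m n)} (hM : IsFeasible k Z M)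
    {x y : Option (Fin m)} {j : Fin n} (hx : (x, j) ∈ M) (hxy : x ≠ y) : (y, j) ∉ M :=
  fun h => hxy (congrArg Prod.fst (hM.1.1 _ hx _ h rfl))

/-- An edge at `j` may become as cheap as the ghost edge at `j`. -/
theorem IsBest.lower_of_ghost {c : Edge m n → ℝ} {Z : Finset (Fin n)} {M : Finset (Edge m n)}
    (hM : IsBest k Z c M) {a : Fin m} {j : Fin n} (he : (some a, j) ∉ M) :
    IsBest k Z (Function.update c (some a, j) (c (none, j))) M := by
  refine ⟨hM.1, fun N hN => ?_⟩
  rw [cost_update_of_notMem he]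
  by_cases h : (some a, j) ∈ N
  · rw [cost_update_of_mem h]
    obtain ⟨h1, h2⟩ := hN.replace h (y := none) (Or.inl rfl) (by simp)
    rw [← h2 c]
    exact hM.2 _ h1
  · rw [cost_update_of_notMem h]
    exact hM.2 N hN

/-- A competitor `N` that uses the modified ghost edge but not `a` can use `(a, j)` instead at the
same cost. If `N` uses both, an exchange with `M'`, which avoids `a`, separates the edge at `a` from
the ghost edge; the two resulting matchings are then bounded individually. -/
theorem cost_ge_of_lower_ghost (hk : k ≤ n) {b : Fin n} {Z : Finset (Fin n)} (hZ : Z ⊆ {b})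
    {c : Edge m n → ℝ} {M' M : Finset (Edge m n)} (hM' : IsBest k {b} c M')
    (hM : IsBest k Z c M) {a : Fin m} {j : Fin n}
    (ha : ∀ i, (some a, i) ∉ M') (hg : (none, j) ∉ M') {N : Finset (Edge m n)}
    (hN : IsFeasible k Z N) :
    cost c M ≤ cost (Function.update c (none, j) (c (some a, j))) N := by
  set c' := Function.update c (none, j) (c (some a, j)) with hc'
  have key : ∀ {W : Finset (Fin n)} {L N : Finset (Edge m n)}, IsBest k W c L →
      IsFeasible k W N → ((none, j) ∈ N → ∀ i, (some a, i) ∉ N) → cost c L ≤ cost c' N := by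
    intro W L N hL hN h
    by_cases hj : (none, j) ∈ N
    · rw [hc', cost_update_of_mem hj]
      obtain ⟨h1, h2⟩ := hN.replace hj (y := some a) (Or.inr (h hj)) (by simp)
      rw [← h2 c]
      exact hL.2 _ h1
    · rw [hc', cost_update_of_notMem hj]
      exact hL.2 _ hN
  by_cases hj : (none, j) ∈ N
  swap
  · exact key hM hN fun h => absurd h hj
  by_cases hi : ∃ i, (some a, i) ∈ N
  swap
  · exact key hM hN fun _ i hi' => hi ⟨i, hi'⟩
  obtain ⟨i, hi⟩ := hi
  obtain ⟨P, Q, ht, hs, -, hQa, hQg⟩ :=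
    exchange hk (Finset.Subset.refl _) hZ hM'.1 hN hi (Or.inr ha)
  have hij : j ≠ i := by
    rintro rfl
    exact hN.not_both hj (by simp) hi
  have hQj : (none, j) ∈ Q := hQg j hij hj
  have hPj : (none, j) ∉ P := by
    intro hP
    -- The cost that is `1` at this ghost edge and `0` elsewhere counts its occurrences. It occurs
    -- once in `M'` and `N` together, hence not in both `P` and `Q`.
    have h := hs (Function.update 0 (none, j) 1)
    rw [cost_update_of_mem hP, cost_update_of_mem hQj, cost_update_of_mem hj,
      cost_update_of_notMem hg] at h
    simp [cost] at h
  have h := hs c'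
  have hM'c : cost c' M' = cost c M' := cost_update_of_notMem hg _
  rcases ht with ⟨hP, hQ⟩ | ⟨-, hP, hQ⟩
  · have h1 := key hM' hP fun h => absurd h hPj
    have h2 := key hM hQ fun _ => hQa (by simp)
    linarith
  · have h1 := key hM hP fun h => absurd h hPj
    have h2 := key hM' hQ fun _ => hQa (by simp)
    linarith

/-- Edges whose left end (in the case of a ghost edge: the edge itself) is not used by `M'`. -/
def IsNew (M' : Finset (Edge m n)) (e : Edge m n) : Prop :=
  (e.1 = none → e ∉ M') ∧ (e.1 ≠ none → ∀ j, (e.1, j) ∉ M')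

/-- With `{b}` as the second forbidden set the exchange keeps the two types of matching apart, so
its results compete with `M` and `M'`. The conserved sum of the two optimal costs forces equality,
and the matching now containing `(x, j)` is `M` by injectivity. -/
theorem mem_of_isBest (hk : k ≤ n) {b : Fin n} {c : Edge m n → ℝ}
    (hc : Function.Injective (cost c)) {M' M : Finset (Edge m n)} (hM' : IsBest k {b} c M')
    (hM : IsBest k ∅ c M) {x : Option (Fin m)} {j : Fin n} (h : (x, j) ∈ M')
    (hx : x = none ∨ ∀ i, (x, i) ∉ M) : (x, j) ∈ M := by
  obtain ⟨P, Q, ht, hs, hP, -⟩ :=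
    exchange hk (Finset.empty_subset {b}) (Finset.Subset.refl {b}) hM.1 hM'.1 h hx
  rcases ht with ⟨hP', hQ'⟩ | ⟨h0, -⟩
  · have h1 := hM.2 _ hP'
    have h2 := hM'.2 _ hQ'
    have h3 : cost c P = cost c M := by linarith [hs c]
    rwa [← hc h3]
  · simp at h0

open scoped Classical in
/-- The optimal matching on the whole graph uses exactly one vertex more on the left than the one
on the smaller graph. -/
theorem exists_new_edge (hk : k ≤ n) {b : Fin n} {c : Edge m n → ℝ}
    (hc : Function.Injective (cost c)) {M' M : Finset (Edge m n)} (hM' : IsBest k {b} c M')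
    (hM : IsBest k ∅ c M) :
    ∃ e, M.filter (IsNew M') = {e} ∧
      ghostCount M = ghostCount M' + if e.1 = none then 1 else 0 := by
  have hg : ∀ j, (none, j) ∈ M' → (none, j) ∈ M := fun j h =>
    mem_of_isBest hk hc hM' hM h (Or.inl rfl)
  have hl : ∀ x j, (x, j) ∈ M' → ∃ i, (x, i) ∈ M ∧ (x = none → i = j) := by
    intro x j h
    rcases x with _ | a
    · exact ⟨j, hg j h, fun _ => rfl⟩
    · by_contra hcon
      simp only [reduceCtorEq, IsEmpty.forall_iff, and_true, not_exists] at hcon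
      exact hcon j (mem_of_isBest hk hc hM' hM h (Or.inr hcon))
  choose! φ hφ hφ' using hl
  -- Edges of `M'` correspond to the edges of `M` with the same left end, ghost edges to themselves.
  -- So `k - 1` of the `k` edges of `M` are not new.
  have hcard : M'.card = (M.filter fun e => ¬ IsNew M' e).card := by
    refine Finset.card_bij (fun e _ => (e.1, φ e.1 e.2)) ?_ ?_ ?_
    · rintro ⟨x, j⟩ he
      refine Finset.mem_filter.2 ⟨hφ x j he, fun hnew => ?_⟩
      by_cases hx : x = none
      · refine hnew.1 hx ?_
        have := hφ' x j he hx
        simp only [this]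
        exact he
      · exact hnew.2 hx j he
    · rintro ⟨x, j⟩ he ⟨x', j'⟩ he' h
      obtain ⟨h1, h2⟩ := Prod.ext_iff.1 h
      dsimp only at h1 h2
      subst h1
      by_cases hx : x = none
      · rw [hφ' x j he hx, hφ' x j' he' hx] at h2
        rw [h2]
      · exact hM'.1.1.2 _ he _ he' hx rfl
    · rintro ⟨x, j⟩ he
      obtain ⟨he, hnew⟩ := Finset.mem_filter.1 he
      by_cases hx : x = none
      · have : (x, j) ∈ M' := by
          by_contra h
          exact hnew ⟨fun _ => h, fun h => absurd hx h⟩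
        exact ⟨(x, j), this, Prod.ext rfl (hφ' x j this hx)⟩
      · have : ∃ i, (x, i) ∈ M' := by
          by_contra h
          exact hnew ⟨fun h => absurd h hx, fun _ i hi => h ⟨i, hi⟩⟩
        obtain ⟨i, hi⟩ := this
        exact ⟨(x, i), hi, hM.1.1.2 _ (hφ x i hi) _ he hx rfl⟩
  have hone : (M.filter (IsNew M')).card = 1 := by
    have h1 := Finset.card_filter_add_card_filter_not (s := M) (IsNew M')
    have h2 := hM.1.2.2
    have h3 := hM'.1.2.2
    simp only [Finset.card_empty, Finset.card_singleton] at h2 h3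
    omega
  obtain ⟨e, he⟩ := Finset.card_eq_one.1 hone
  refine ⟨e, he, ?_⟩
  have h1 : (M.filter fun e => e.1 = none) =
      (M'.filter fun e => e.1 = none) ∪ ((M.filter (IsNew M')).filter fun e => e.1 = none) := by
    ext ⟨x, j⟩
    simp only [Finset.mem_filter, Finset.mem_union]
    constructor
    · rintro ⟨h, rfl⟩
      by_cases h' : (none, j) ∈ M'
      · exact Or.inl ⟨h', rfl⟩
      · exact Or.inr ⟨⟨h, ⟨fun _ => h', fun h => absurd rfl h⟩⟩, rfl⟩
    · rintro (⟨h, rfl⟩ | ⟨⟨h, -⟩, rfl⟩)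
      · exact ⟨hg j h, rfl⟩
      · exact ⟨h, rfl⟩
  unfold ghostCount
  rw [h1, Finset.card_union_of_disjoint, he, Finset.filter_singleton]
  · split_ifs <;> simp
  · rw [Finset.disjoint_left]
    rintro ⟨x, j⟩ h h'
    simp only [Finset.mem_filter] at h h'
    exact h'.1.2.1 h'.2 h.1

open scoped Classical in
-- All edges but the ghost edges occupy different ordinary left vertices, and there are `k - Z.card`
-- edges. For `Z = {b}` this leaves the `m - k + d + 1` candidates for a new left vertex.
theorem card_unused_left {M : Finset (Edge m n)} {Z : Finset (Fin n)} (hM : IsFeasible k Z M) :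
    (Finset.univ.filter fun a : Fin m => ∀ j, (some a, j) ∉ M).card + k
      = m + ghostCount M + Z.card := by
  have h1 : (Finset.univ.filter fun a : Fin m => ¬ ∀ j, (some a, j) ∉ M).card =
      (M.filter fun e => ¬ e.1 = none).card := by
    symm
    refine Finset.card_bij (fun e he => e.1.get (Option.isSome_iff_ne_none.2
      (Finset.mem_filter.1 he).2)) ?_ ?_ ?_
    · rintro ⟨x, j⟩ he
      simp only [Finset.mem_filter, Finset.mem_univ, true_and, not_forall, not_not,
        Option.some_get] at he ⊢
      exact ⟨j, he.1⟩
    · rintro e he e' he' h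
      have h : e.1 = e'.1 := by
        have := congrArg some h
        simpa using this
      exact hM.1.2 e (Finset.mem_filter.1 he).1 e' (Finset.mem_filter.1 he').1
        (Finset.mem_filter.1 he).2 h
    · intro a ha
      simp only [Finset.mem_filter, Finset.mem_univ, true_and, not_forall, not_not] at ha
      obtain ⟨j, hj⟩ := ha
      exact ⟨(some a, j), by simp [hj], by simp⟩
  have h2 := Finset.card_filter_add_card_filter_not (s := (Finset.univ : Finset (Fin m)))
    (fun a : Fin m => ∀ j, (some a, j) ∉ M)
  have h3 := Finset.card_filter_add_card_filter_not (s := M) (fun e => e.1 = none)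
  have h4 := hM.2.2
  rw [Finset.card_univ, Fintype.card_fin] at h2
  unfold ghostCount
  omega

/-! ### Reduction to tied costs of an ordinary edge and the ghost edge at the same right vertex. -/

/-- `M'` is optimal on the smaller graph, and some optimal matching contains `e` and has its cost
in `B`. -/
def Uses (k : ℕ) (b : Fin n) (M' : Finset (Edge m n)) (e : Edge m n) (B : Set ℝ) :
    Set (Edge m n → ℝ) :=
  {c | IsBest k {b} c M' ∧ ∃ M, IsBest k ∅ c M ∧ e ∈ M ∧ cost c M ∈ B}

/-- As `Uses` for the ghost edge at `j`, with `a` not used by the optimal matching. -/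
def UsesGhost (k : ℕ) (b : Fin n) (M' : Finset (Edge m n)) (a : Fin m) (j : Fin n) (B : Set ℝ) :
    Set (Edge m n → ℝ) :=
  {c | IsBest k {b} c M' ∧ ∃ M, IsBest k ∅ c M ∧ (none, j) ∈ M ∧ (∀ i, (some a, i) ∉ M) ∧
    cost c M ∈ B}

theorem left_notMem_of_ghost_mem (hk : k ≤ n) {b : Fin n} {c : Edge m n → ℝ}
    (hc : Function.Injective (cost c)) {M' M : Finset (Edge m n)} (hM' : IsBest k {b} c M')
    (hM : IsBest k ∅ c M) {a : Fin m} {j : Fin n} (ha : ∀ i, (some a, i) ∉ M')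
    (hg : (none, j) ∉ M') (hgM : (none, j) ∈ M) (i : Fin n) : (some a, i) ∉ M := by
  classical
  intro hi
  obtain ⟨e, he, -⟩ := exists_new_edge hk hc hM' hM
  have h1 : ((some a, i) : Edge m n) ∈ M.filter (IsNew M') :=
    Finset.mem_filter.2 ⟨hi, by simp, fun _ => ha⟩
  have h2 : ((none, j) : Edge m n) ∈ M.filter (IsNew M') :=
    Finset.mem_filter.2 ⟨hgM, fun _ => hg, by simp⟩
  rw [he, Finset.mem_singleton] at h1 h2
  simp [← h2] at h1

section Tie

variable {b : Fin n} {M' : Finset (Edge m n)} {a : Fin m} {j : Fin n} {B : Set ℝ}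
  {c : Edge m n → ℝ}

/-- At tied costs the two edges are interchangeable in an optimal matching. Lowering the ghost edge
to the tie leaves the optimal costs unchanged by `cost_ge_of_lower_ghost`; raising it back does not
affect the optimality of matchings avoiding it. -/
theorem mem_uses_iff_of_lt (hk : k ≤ n) (ha : ∀ i, (some a, i) ∉ M') (hg : (none, j) ∉ M')
    (hlt : c (some a, j) < c (none, j)) :
    c ∈ Uses k b M' (some a, j) B ↔
      Function.update c (none, j) (c (some a, j)) ∈ UsesGhost k b M' a j B := by
  have hne : ((some a, j) : Edge m n) ≠ (none, j) := by simp
  set c' := Function.update c (none, j) (c (some a, j)) with hc'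
  have hc1 : c' (none, j) = c (some a, j) := Function.update_self ..
  have hc2 : c' (some a, j) = c (some a, j) := Function.update_of_ne hne ..
  constructor
  · rintro ⟨hM', M, hM, haM, hB⟩
    have hgM : (none, j) ∉ M := hM.1.not_both haM (by simp)
    have hM1 : cost c' M = cost c M := cost_update_of_notMem hgM _
    have hM2 : cost c' M' = cost c M' := cost_update_of_notMem hg _
    have hbest : IsBest k ∅ c' M := ⟨hM.1, fun N hN => by
      rw [hM1]
      exact cost_ge_of_lower_ghost hk (Finset.empty_subset _) hM' hM ha hg hN⟩
    obtain ⟨h1, h2⟩ := hM.1.replace haM (y := none) (Or.inl rfl) (by simp)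
    have h3 := h2 c'
    rw [hc1, hc2, sub_add_cancel] at h3
    refine ⟨⟨hM'.1, fun N hN => ?_⟩, _, hbest.of_cost_le h1 h3.le,
      Finset.mem_insert_self _ _, fun i hi => ?_, ?_⟩
    · rw [hM2]
      exact cost_ge_of_lower_ghost hk (Finset.Subset.refl _) hM' hM' ha hg hN
    · rcases Finset.mem_insert.1 hi with hi | hi
      · simp at hi
      · obtain ⟨hi, hi'⟩ := Finset.mem_erase.1 hi
        exact hi (hM.1.1.2 _ hi' _ haM (by simp) rfl)
    · rwa [h3, hM1]
  · rintro ⟨hM', M, hM, hgM, haM, hB⟩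
    have hcc : Function.update c' (none, j) (c (none, j)) = c := by simp [hc']
    obtain ⟨h1, h2⟩ := hM.1.replace hgM (y := some a) (Or.inr haM) (by simp)
    have h3 := h2 c'
    rw [hc1, hc2, sub_add_cancel] at h3
    have hnot : ((none, j) : Edge m n) ∉ insert (some a, j) (M.erase (none, j)) := by simp
    have hv : c' (none, j) ≤ c (none, j) := by
      rw [hc1]
      exact hlt.le
    have hbest := (hM.of_cost_le h1 h3.le).raise hnot hv
    have hbest' := hM'.raise hg hv
    rw [hcc] at hbest hbest'
    refine ⟨hbest', _, hbest, Finset.mem_insert_self _ _, ?_⟩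
    rw [← hcc, cost_update_of_notMem hnot, h3]
    exact hB

/-- The tied event is the same as in `mem_uses_iff_of_lt`, so the two uses differ only in which cost
is smaller. Lowering `(a, j)` to the tie is harmless, because any competitor may take the ghost edge
at `j` instead. -/
theorem mem_uses_ghost_iff_of_lt (hk : k ≤ n) (hc : Function.Injective (cost c))
    (ha : ∀ i, (some a, i) ∉ M') (hg : (none, j) ∉ M')
    (hlt : c (none, j) < c (some a, j)) :
    c ∈ Uses k b M' (none, j) B ↔
      Function.update c (some a, j) (c (none, j)) ∈ UsesGhost k b M' a j B := by
  set c' := Function.update c (some a, j) (c (none, j)) with hc'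
  constructor
  · rintro ⟨hM', M, hM, hgM, hB⟩
    have haM := left_notMem_of_ghost_mem hk hc hM' hM ha hg hgM
    refine ⟨hM'.lower_of_ghost (ha j), M, hM.lower_of_ghost (haM j), hgM, haM, ?_⟩
    rwa [cost_update_of_notMem (haM j)]
  · rintro ⟨hM', M, hM, hgM, haM, hB⟩
    have hcc : Function.update c' (some a, j) (c (some a, j)) = c := by simp [hc']
    have hv : c' (some a, j) ≤ c (some a, j) := by
      rw [hc', Function.update_self]
      exact hlt.le
    have hbest := hM.raise (haM j) hv
    have hbest' := hM'.raise (ha j) hv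
    rw [hcc] at hbest hbest'
    refine ⟨hbest', M, hbest, hgM, ?_⟩
    rw [← hcc, cost_update_of_notMem (haM j)]
    exact hB

end Tie

/-! ### Product measures: restriction and resampling of coordinates. -/

theorem measurePreserving_comp {ι κ : Type*} [Fintype ι] [Fintype κ] (μ : ι → Measure ℝ)
    [∀ i, IsProbabilityMeasure (μ i)] {g : κ → ι} (hg : Function.Injective g) :
    MeasurePreserving (fun (c : ι → ℝ) k => c (g k)) (Measure.pi μ)
      (Measure.pi fun k => μ (g k)) := by
  refine ⟨by fun_prop, ?_⟩
  have h := (iIndepFun_pi (μ := μ) (X := fun _ x => x) (fun i => aemeasurable_id)).precomp hg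
  rw [iIndepFun_iff_map_fun_eq_pi_map (fun i => (measurable_pi_apply _).aemeasurable)] at h
  rw [h]
  congr 1
  ext1 k
  exact (measurePreserving_eval μ (g k)).map_eq

section Product

variable {ι : Type*} [Fintype ι] [DecidableEq ι] (μ : ι → Measure ℝ)
  [∀ i, IsProbabilityMeasure (μ i)]

/-- Resampling one coordinate preserves a product measure. -/
theorem measurePreserving_update (i : ι) :
    MeasurePreserving (fun p : (ι → ℝ) × ℝ => Function.update p.1 i p.2)
      ((Measure.pi μ).prod (μ i)) (Measure.pi μ) := by
  have hm : Measurable (fun p : (ι → ℝ) × ℝ => Function.update p.1 i p.2) := measurable_update'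
  refine ⟨hm, (Measure.pi_eq fun s hs => ?_).symm⟩
  rw [Measure.map_apply hm (MeasurableSet.univ_pi hs)]
  have : (fun p : (ι → ℝ) × ℝ => Function.update p.1 i p.2) ⁻¹' Set.univ.pi s =
      (Set.univ.pi (Function.update s i Set.univ)) ×ˢ s i := by
    ext ⟨c, x⟩
    simp only [Set.mem_preimage, Set.mem_pi, Set.mem_univ, true_imp_iff, Set.mem_prod]
    constructor
    · intro h
      refine ⟨fun j => ?_, by simpa using h i⟩
      by_cases hj : j = i
      · subst hj
        simp
      · simpa [hj] using h j
    · rintro ⟨h1, h2⟩ j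
      by_cases hj : j = i
      · subst hj
        simpa using h2
      · simpa [hj] using h1 j
  rw [this, Measure.prod_prod, Measure.pi_pi, ← Finset.mul_prod_erase Finset.univ _ (Finset.mem_univ i),
    ← Finset.mul_prod_erase Finset.univ (fun j => μ j (s j)) (Finset.mem_univ i)]
  simp only [Function.update_self, measure_univ, one_mul]
  rw [mul_comm]
  congr 1
  refine Finset.prod_congr rfl fun j hj => ?_
  rw [Function.update_of_ne (Finset.ne_of_mem_erase hj)]

/-- After resampling the coordinates `i` and `j` as `x` and `y`, the tied configuration involves `x`
only. Integrating out `y` over `y > x` leaves the tail of `μ j`. -/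
theorem measure_tie (i j : ι) (hij : i ≠ j) {A : Set (ι → ℝ)} (hA : MeasurableSet A) :
    Measure.pi μ {c | c i < c j ∧ Function.update c j (c i) ∈ A} =
      ∫⁻ c, ∫⁻ x, A.indicator 1 (Function.update (Function.update c i x) j x) * μ j (Set.Ioi x)
        ∂μ i ∂Measure.pi μ := by
  set S : Set (ι → ℝ) := {c | c i < c j ∧ Function.update c j (c i) ∈ A} with hS
  have hSm : MeasurableSet S := by
    refine MeasurableSet.inter (measurableSet_lt (measurable_pi_apply i) (measurable_pi_apply j)) ?_
    have : Measurable ((fun p : (ι → ℝ) × ℝ => Function.update p.1 j p.2) ∘ fun c => (c, c i)) :=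
      measurable_update'.comp (measurable_id.prodMk (measurable_pi_apply i))
    exact this hA
  have hf : Measurable (S.indicator (1 : (ι → ℝ) → ENNReal)) := measurable_one.indicator hSm
  have hf' : Measurable fun p : (ι → ℝ) × ℝ =>
    S.indicator (1 : (ι → ℝ) → ENNReal) (Function.update p.1 i p.2) := hf.comp measurable_update'
  rw [← lintegral_indicator_one hSm, ← (measurePreserving_update μ i).lintegral_comp hf,
    lintegral_prod _ hf'.aemeasurable]
  have h2 : ∀ g : (ι → ℝ) → ENNReal, Measurable g → ∫⁻ c, g c ∂Measure.pi μ =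
      ∫⁻ c, ∫⁻ y, g (Function.update c j y) ∂μ j ∂Measure.pi μ := fun g hg => by
    have hg' : Measurable fun p : (ι → ℝ) × ℝ => g (Function.update p.1 j p.2) :=
      hg.comp measurable_update'
    rw [← (measurePreserving_update μ j).lintegral_comp hg, lintegral_prod _ hg'.aemeasurable]
  have hg : Measurable fun c : ι → ℝ =>
      ∫⁻ x, S.indicator (1 : (ι → ℝ) → ENNReal) (Function.update c i x) ∂μ i :=
    hf'.lintegral_prod_right'
  rw [h2 _ hg]
  refine lintegral_congr fun c => ?_
  have hm2 : Measurable (Function.uncurry fun (y x : ℝ) =>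
      S.indicator (1 : (ι → ℝ) → ENNReal) (Function.update (Function.update c j y) i x)) := by
    refine hf.comp (measurable_update'.comp (Measurable.prodMk ?_ measurable_snd))
    exact (measurable_update c).comp measurable_fst
  rw [lintegral_lintegral_swap hm2.aemeasurable]
  refine lintegral_congr fun x => ?_
  have : ∀ y, S.indicator (1 : (ι → ℝ) → ENNReal) (Function.update (Function.update c j y) i x) =
      A.indicator 1 (Function.update (Function.update c i x) j x) * (Set.Ioi x).indicator 1 y := by
    intro y
    have : (Function.update (Function.update c j y) i x ∈ S) ↔
        x < y ∧ Function.update (Function.update c i x) j x ∈ A := by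
      simp only [hS, Set.mem_ofPred_eq, Function.update_self, Function.update_of_ne hij.symm]
      rw [Function.update_comm hij, Function.update_idem, Function.update_comm hij.symm]
    by_cases h1 : x < y <;>
      by_cases h3 : Function.update (Function.update c i x) j x ∈ A <;>
      simp [Set.indicator, this, h1, h3]
  simp_rw [this]
  rw [lintegral_const_mul _ (measurable_one.indicator measurableSet_Ioi),
    lintegral_indicator_one measurableSet_Ioi]

end Product

/-! ### Exponential variables. -/

section Exponential

theorem expMeasure_eq (r : ℝ) :
    expMeasure r = (volume : Measure ℝ).withDensity (exponentialPDF r) := rfl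

theorem measurable_exponentialPDF (r : ℝ) : Measurable (exponentialPDF r) :=
  (measurable_exponentialPDFReal r).ennreal_ofReal

theorem expMeasure_Ioi {r : ℝ} (hr : 0 < r) {x : ℝ} (hx : 0 ≤ x) :
    expMeasure r (Set.Ioi x) = ENNReal.ofReal (Real.exp (-(r * x))) := by
  have := isProbabilityMeasure_expMeasure hr
  rw [← Set.compl_Iic, prob_compl_eq_one_sub measurableSet_Iic, expMeasure_eq,
    withDensity_apply _ measurableSet_Iic, lintegral_exponentialPDF_eq_antiDeriv hr, if_pos hx,
    ← ENNReal.ofReal_one, ← ENNReal.ofReal_sub]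
  · congr 1
    ring
  · rw [sub_nonneg, Real.exp_le_one_iff]
    nlinarith

instance nullSingletonClass_expMeasure (r : ℝ) : NullSingletonClass (expMeasure r) :=
  ⟨fun x => withDensity_absolutelyContinuous _ _ (measure_singleton x)⟩

theorem ae_nonneg_expMeasure (r : ℝ) : ∀ᵐ x ∂expMeasure r, 0 ≤ x := by
  have : {x : ℝ | ¬ 0 ≤ x} = Set.Iio 0 := by
    ext
    simp
  rw [ae_iff, this, expMeasure_eq, withDensity_apply _ measurableSet_Iio]
  refine (lintegral_eq_zero_iff (measurable_exponentialPDF r)).2 ?_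
  filter_upwards [ae_restrict_mem measurableSet_Iio] with x hx
  exact exponentialPDF_of_neg hx

theorem integral_expMeasure (r : ℝ) (hr : 0 < r) (f : ℝ → ℂ) :
    ∫ x, f x ∂expMeasure r = ∫ x in Set.Ioi 0, ((r * Real.exp (-(r * x)) : ℝ) : ℂ) * f x := by
  rw [expMeasure_eq, integral_withDensity_eq_integral_toReal_smul (measurable_exponentialPDF r)
    (ae_of_all _ fun x => ENNReal.ofReal_lt_top), ← integral_Ici_eq_integral_Ioi,
    ← integral_indicator measurableSet_Ici]
  refine integral_congr_ae (ae_of_all _ fun x => ?_)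
  simp only [exponentialPDF_eq, Set.indicator, Set.mem_Ici]
  split_ifs with hx
  · rw [ENNReal.toReal_ofReal (by positivity)]
    simp
  · simp

/-- Two independent exponential variables, the smaller of which is seen only through its value. -/
theorem measure_tie_exponential {ι : Type*} [Fintype ι] [DecidableEq ι] (μ : ι → Measure ℝ)
    [∀ i, IsProbabilityMeasure (μ i)] {i j : ι} (hij : i ≠ j) {r s : ℝ} (hr : 0 < r) (hs : 0 < s)
    (hi : μ i = expMeasure r) (hj : μ j = expMeasure s) {A : Set (ι → ℝ)} (hA : MeasurableSet A) :
    ENNReal.ofReal s * Measure.pi μ {c | c i < c j ∧ Function.update c j (c i) ∈ A} =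
      ENNReal.ofReal r * Measure.pi μ {c | c j < c i ∧ Function.update c i (c j) ∈ A} := by
  rw [measure_tie μ i j hij hA, measure_tie μ j i hij.symm hA,
    ← lintegral_const_mul' _ _ ENNReal.ofReal_ne_top,
    ← lintegral_const_mul' _ _ ENNReal.ofReal_ne_top]
  refine lintegral_congr fun c => ?_
  rw [hi, hj, ← lintegral_const_mul' _ _ ENNReal.ofReal_ne_top,
    ← lintegral_const_mul' _ _ ENNReal.ofReal_ne_top]
  have hmA : Measurable fun x : ℝ =>
      A.indicator (1 : (ι → ℝ) → ENNReal) (Function.update (Function.update c i x) j x) :=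
    (measurable_one.indicator hA).comp
      (measurable_update'.comp ((measurable_update c).prodMk measurable_id))
  have hanti : ∀ r, Measurable fun x : ℝ => expMeasure r (Set.Ioi x) := fun r =>
    Antitone.measurable fun x y h => measure_mono (Set.Ioi_subset_Ioi h)
  simp_rw [Function.update_comm hij.symm]
  have conv : ∀ r s, ∫⁻ x, ENNReal.ofReal s *
      (A.indicator (1 : (ι → ℝ) → ENNReal) (Function.update (Function.update c i x) j x) *
        expMeasure s (Set.Ioi x)) ∂expMeasure r = ∫⁻ x, exponentialPDF r x * (ENNReal.ofReal s *
      (A.indicator (1 : (ι → ℝ) → ENNReal) (Function.update (Function.update c i x) j x) *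
        expMeasure s (Set.Ioi x))) := fun r s => by
    rw [expMeasure_eq r]
    exact lintegral_withDensity_eq_lintegral_mul _ (measurable_exponentialPDF r)
      ((hmA.mul (hanti s)).const_mul _)
  rw [conv, conv]
  refine lintegral_congr fun x => ?_
  rcases lt_or_ge x 0 with hx | hx
  · simp [exponentialPDF_of_neg hx]
  -- On both sides the tied value `x` has density `r s exp(-(r+s)x)`, which is symmetric in the two
  -- rates.
  · rw [exponentialPDF_of_nonneg hx, exponentialPDF_of_nonneg hx, expMeasure_Ioi hr hx,
      expMeasure_Ioi hs hx, ENNReal.ofReal_mul hr.le, ENNReal.ofReal_mul hs.le]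
    ring

/-- This is integration by parts against the exponential density. Since `min x T` is constant beyond
`T`, no condition on `t` is needed. The form as one vanishing integral is the one that Fubini calls
for later. -/
theorem integral_exp_min_expMeasure {h T : ℝ} (hh : 0 < h) (hT : 0 ≤ T) (t : ℂ) :
    ∫ x, (Complex.exp (t * (min x T : ℝ)) - 1 -
      t / h * (if x ≤ T then Complex.exp (t * x) else 0)) ∂expMeasure h = 0 := by
  have hh' : (h : ℂ) ≠ 0 := by exact_mod_cast hh.ne'
  set G : ℝ → ℂ := fun x => ((h * Real.exp (-(h * x)) : ℝ) : ℂ) *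
    (Complex.exp (t * (min x T : ℝ)) - 1 - t / h * (if x ≤ T then Complex.exp (t * x) else 0))
    with hG
  rw [integral_expMeasure h hh]
  change ∫ x in Set.Ioi 0, G x = 0
  -- `G₁` is the derivative of `-exp((t-h)x) + exp(-hx)`; beyond `T` the integrand is instead a
  -- multiple of `exp(-hx)`.
  set G₁ : ℝ → ℂ := fun x => (h - t) * Complex.exp ((t - h) * x) - h * Complex.exp (-h * x)
    with hG₁
  have e1 : ∀ x < T, G x = G₁ x := by
    intro x hx
    simp only [hG, hG₁, min_eq_left hx.le, if_pos hx.le, sub_mul, Complex.exp_sub]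
    push_cast
    rw [Complex.exp_neg, neg_mul, Complex.exp_neg]
    field_simp
    ring
  have e2 : ∀ x, T < x → G x = (h * (Complex.exp (t * T) - 1)) * Complex.exp (-h * x) := by
    intro x hx
    simp only [hG, min_eq_right hx.le, if_neg hx.not_ge]
    push_cast
    rw [neg_mul]
    ring
  have hcont : Continuous G₁ := by fun_prop
  have i1 : IntegrableOn G (Set.Ioc 0 T) := by
    rw [integrableOn_Ioc_iff_integrableOn_Ioo]
    refine IntegrableOn.congr_fun ?_ (fun x hx => (e1 x hx.2).symm) measurableSet_Ioo
    exact (hcont.integrableOn_Icc (a := 0) (b := T)).mono_set Set.Ioo_subset_Icc_self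
  have hre : (-(h : ℂ)).re < 0 := by simpa using hh
  have i2 : IntegrableOn G (Set.Ioi T) := by
    refine IntegrableOn.congr_fun ?_ (fun x hx => (e2 x hx).symm) measurableSet_Ioi
    exact (integrableOn_exp_mul_complex_Ioi hre T).const_mul _
  rw [← Set.Ioc_union_Ioi_eq_Ioi hT, setIntegral_union (Set.Ioc_disjoint_Ioi le_rfl)
    measurableSet_Ioi i1 i2]
  have v2 : ∫ x in Set.Ioi T, G x =
      (Complex.exp (t * T) - 1) * Complex.exp (-h * T) := by
    rw [setIntegral_congr_fun measurableSet_Ioi fun x hx => e2 x hx,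
      integral_const_mul, integral_exp_mul_complex_Ioi hre]
    field_simp
  have v1 : ∫ x in Set.Ioc 0 T, G x =
      (-Complex.exp ((t - h) * T) + Complex.exp (-h * T)) - (-1 + 1) := by
    rw [integral_Ioc_eq_integral_Ioo, setIntegral_congr_fun measurableSet_Ioo fun x hx => e1 x hx.2,
      ← integral_Ioc_eq_integral_Ioo, ← intervalIntegral.integral_of_le hT]
    have hd : ∀ x : ℝ, HasDerivAt
        (fun x : ℝ => -Complex.exp ((t - h) * x) + Complex.exp (-h * x)) (G₁ x) x := by
      intro x
      have d : ∀ a : ℂ, HasDerivAt (fun x : ℝ => Complex.exp (a * x))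
          (Complex.exp (a * x) * (a * 1)) x := fun a =>
        ((Complex.ofRealCLM.hasDerivAt (x := x)).const_mul a).cexp
      have e : G₁ x = -(Complex.exp ((t - h) * x) * ((t - h) * 1)) +
          Complex.exp (-h * x) * (-h * 1) := by
        simp only [hG₁]
        ring
      rw [e]
      exact (d (t - h)).neg.add (d (-h))
    rw [intervalIntegral.integral_eq_sub_of_hasDerivAt (fun x _ => hd x)
      (hcont.intervalIntegrable _ _)]
    simp
  rw [v1, v2, sub_mul t, Complex.exp_sub, neg_mul, Complex.exp_neg]
  field_simp
  ring

end Exponential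

/-! ### The law of the edge costs: almost sure uniqueness of optima, and measurability. -/

theorem rate_pos {h : ℝ} (hh : 0 < h) (e : Edge m n) : 0 < rate h e := by
  unfold rate
  split_ifs
  · exact hh
  · exact one_pos

theorem isProbabilityMeasure_rate {h : ℝ} (hh : 0 < h) (e : Edge m n) :
    IsProbabilityMeasure (expMeasure (rate h e)) :=
  isProbabilityMeasure_expMeasure (rate_pos hh e)

theorem isProbabilityMeasure_costLaw {h : ℝ} (hh : 0 < h) :
    IsProbabilityMeasure (costLaw m n h) := by
  have := isProbabilityMeasure_rate (m := m) (n := n) hh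
  unfold costLaw
  infer_instance

theorem measurable_cost (M : Finset (Edge m n)) : Measurable fun c : Edge m n → ℝ => cost c M :=
  Finset.measurable_fun_sum _ fun e _ => measurable_pi_apply e

theorem ae_nonneg_costLaw {h : ℝ} (hh : 0 < h) : ∀ᵐ c ∂costLaw m n h, ∀ e, 0 ≤ c e := by
  have := isProbabilityMeasure_rate (m := m) (n := n) hh
  rw [ae_all_iff]
  intro e
  exact (measurePreserving_eval (fun e : Edge m n => expMeasure (rate h e))
    e).quasiMeasurePreserving.ae (ae_nonneg_expMeasure _)

/-- Once all costs other than that of `e` are fixed, equality prescribes a single value for the cost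
of `e`, and the exponential law has no atoms. -/
theorem ae_cost_ne {h : ℝ} (hh : 0 < h) {M N : Finset (Edge m n)} {e : Edge m n} (heM : e ∈ M)
    (heN : e ∉ N) : ∀ᵐ c ∂costLaw m n h, cost c M ≠ cost c N := by
  have := isProbabilityMeasure_rate (m := m) (n := n) hh
  have hm : MeasurableSet {c : Edge m n → ℝ | cost c M ≠ cost c N} :=
    (measurableSet_eq_fun (measurable_cost M) (measurable_cost N)).compl
  unfold costLaw
  have hp := measurePreserving_update (fun e : Edge m n => expMeasure (rate h e)) e
  rw [← hp.map_eq, ae_map_iff hp.measurable.aemeasurable hm]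
  refine Measure.ae_prod_mem_iff_ae_ae_mem (hp.measurable hm) |>.2 (ae_of_all _ fun c => ?_)
  rw [ae_iff]
  refine measure_mono_null (fun x hx => ?_) (measure_singleton (cost c N - cost c M + c e))
  have hx : cost (Function.update c e x) M = cost (Function.update c e x) N := by
    by_contra hcon
    exact hx hcon
  rw [cost_update_of_mem heM, cost_update_of_notMem heN] at hx
  rw [Set.mem_singleton_iff]
  linarith

theorem ae_injective_cost {h : ℝ} (hh : 0 < h) :
    ∀ᵐ c ∂costLaw m n h, Function.Injective (cost c) := by
  have : ∀ᵐ c ∂costLaw m n h, ∀ M N : Finset (Edge m n), M ≠ N → cost c M ≠ cost c N := by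
    rw [ae_all_iff]
    intro M
    rw [ae_all_iff]
    intro N
    by_cases hMN : M = N
    · exact ae_of_all _ fun c h => absurd hMN h
    · have : ∃ e, (e ∈ M ∧ e ∉ N) ∨ (e ∈ N ∧ e ∉ M) := by
        by_contra hcon
        refine hMN (Finset.ext fun e => ?_)
        have := not_exists.1 hcon e
        tauto
      obtain ⟨e, ⟨h1, h2⟩ | ⟨h1, h2⟩⟩ := this
      · filter_upwards [ae_cost_ne hh h1 h2] with c hc _ using hc
      · filter_upwards [ae_cost_ne hh h1 h2] with c hc _ using hc.symm
  filter_upwards [this] with c hc M N hMN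
  by_contra hcon
  exact hc M N hcon hMN

theorem measurableSet_isBest (Z : Finset (Fin n)) (M : Finset (Edge m n)) :
    MeasurableSet {c : Edge m n → ℝ | IsBest k Z c M} := by
  have : {c : Edge m n → ℝ | IsBest k Z c M} =
      {c | IsFeasible k Z M} ∩ ⋂ N, ⋂ _ : IsFeasible k Z N, {c | cost c M ≤ cost c N} := by
    ext c
    simp [IsBest]
  rw [this]
  exact (MeasurableSet.const _).inter (MeasurableSet.iInter fun N => MeasurableSet.iInter fun _ =>
    measurableSet_le (measurable_cost M) (measurable_cost N))

theorem exists_isBest {c : Edge m n → ℝ} {Z : Finset (Fin n)}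
    (h : ∃ M : Finset (Edge m n), IsFeasible k Z M) : ∃ M, IsBest k Z c M := by
  classical
  obtain ⟨M, hM⟩ := h
  obtain ⟨L, hL, hmin⟩ := (Finset.univ.filter fun M : Finset (Edge m n) =>
    IsFeasible k Z M).exists_min_image (cost c) ⟨M, by simpa using hM⟩
  exact ⟨L, by simpa using hL, fun N hN => hmin N (by simpa using hN)⟩

theorem exists_isFeasible {Z : Finset (Fin n)} (hZ : Z.card ≤ k) (hk : k ≤ n) :
    ∃ M : Finset (Edge m n), IsFeasible k Z M := by
  obtain ⟨S, hS, hcard⟩ := Finset.exists_subset_card_eq (s := Zᶜ) (n := k - Z.card) (by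
    rw [Finset.card_compl, Fintype.card_fin]
    omega)
  classical
  refine ⟨S.image fun j => (none, j), ⟨⟨?_, ?_⟩, ?_, ?_⟩⟩
  · simp only [Finset.mem_image]
    rintro _ ⟨i, -, rfl⟩ _ ⟨j, -, rfl⟩ h
    simpa using h
  · simp only [Finset.mem_image]
    rintro _ ⟨i, -, rfl⟩ _ ⟨j, -, rfl⟩ h0
    simp at h0
  · simp only [Finset.mem_image]
    rintro _ ⟨i, hi, rfl⟩
    simpa using hS hi
  · rw [Finset.card_image_of_injective _ fun i j h => by simpa using h, hcard]
    omega

theorem IsBest.minCost_eq {c : Edge m n → ℝ} {M : Finset (Edge m n)} (hM : IsBest k ∅ c M) :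
    minCost k c = cost c M := by
  refine IsLeast.csInf_eq ⟨⟨M, isFeasible_empty_iff.1 hM.1, rfl⟩, ?_⟩
  rintro _ ⟨N, hN, rfl⟩
  exact hM.2 N (isFeasible_empty_iff.2 hN)

theorem mem_ghostEvent {d : ℕ} {c : Edge m n → ℝ} :
    c ∈ ghostEvent k m n d ↔ ∃ M, IsBest k ∅ c M ∧ ghostCount M = d := by
  simp only [ghostEvent, isBest_empty_iff]
  rfl

theorem measurable_minCost (hk : k ≤ n) :
    Measurable fun c : Edge m n → ℝ => minCost k c := by
  intro B hB
  have : (fun c : Edge m n → ℝ => minCost k c) ⁻¹' B =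
      ⋃ M : Finset (Edge m n), {c | IsBest k ∅ c M} ∩ {c | cost c M ∈ B} := by
    ext c
    simp only [Set.mem_preimage, Set.mem_iUnion, Set.mem_inter_iff, Set.mem_ofPred_eq]
    constructor
    · intro h
      obtain ⟨M, hM⟩ := exists_isBest (c := c) (exists_isFeasible (m := m) (Z := ∅) (by simp) hk)
      exact ⟨M, hM, hM.minCost_eq ▸ h⟩
    · rintro ⟨M, hM, h⟩
      rwa [hM.minCost_eq]
  rw [this]
  exact MeasurableSet.iUnion fun M => (measurableSet_isBest _ M).inter (measurable_cost M hB)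

theorem measurableSet_ghostEvent (d : ℕ) : MeasurableSet (ghostEvent k m n d) := by
  have : ghostEvent k m n d =
      ⋃ M : Finset (Edge m n), {c | IsBest k ∅ c M} ∩ {c | ghostCount M = d} := by
    ext c
    simp [mem_ghostEvent]
  rw [this]
  exact MeasurableSet.iUnion fun M => (measurableSet_isBest _ M).inter (MeasurableSet.const _)

/-! ### The probabilities of an ordinary and of a ghost new edge. -/

theorem measurableSet_uses (b : Fin n) (M' : Finset (Edge m n)) (e : Edge m n) {B : Set ℝ}
    (hB : MeasurableSet B) : MeasurableSet (Uses k b M' e B) := by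
  have : Uses k b M' e B = {c | IsBest k {b} c M'} ∩
      ⋃ M : Finset (Edge m n), {c | IsBest k ∅ c M} ∩ ({c | e ∈ M} ∩ {c | cost c M ∈ B}) := by
    ext c
    simp [Uses]
  rw [this]
  exact (measurableSet_isBest _ M').inter (MeasurableSet.iUnion fun M =>
    (measurableSet_isBest _ M).inter ((MeasurableSet.const _).inter (measurable_cost M hB)))

theorem measurableSet_usesGhost (b : Fin n) (M' : Finset (Edge m n)) (a : Fin m) (j : Fin n)
    {B : Set ℝ} (hB : MeasurableSet B) : MeasurableSet (UsesGhost k b M' a j B) := by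
  have : UsesGhost k b M' a j B = {c | IsBest k {b} c M'} ∩
      ⋃ M : Finset (Edge m n), {c | IsBest k ∅ c M} ∩
        ({c | (none, j) ∈ M ∧ ∀ i, (some a, i) ∉ M} ∩ {c | cost c M ∈ B}) := by
    ext c
    simp only [UsesGhost, Set.mem_ofPred_eq, Set.mem_inter_iff, Set.mem_iUnion, and_assoc]
  rw [this]
  exact (measurableSet_isBest _ M').inter (MeasurableSet.iUnion fun M =>
    (measurableSet_isBest _ M).inter ((MeasurableSet.const _).inter (measurable_cost M hB)))

/-- Both events mean that the tied costs lie in `UsesGhost`, with opposite orders of the two edge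
costs. The claim is thus `measure_tie_exponential` for the rates `1` and `h`. -/
theorem measure_uses {h : ℝ} (hh : 0 < h) (hk : k ≤ n) (b : Fin n) {M' : Finset (Edge m n)}
    {a : Fin m} {j : Fin n} (ha : ∀ i, (some a, i) ∉ M') (hg : (none, j) ∉ M') {B : Set ℝ}
    (hB : MeasurableSet B) :
    ENNReal.ofReal h * costLaw m n h (Uses k b M' (some a, j) B) =
      costLaw m n h (Uses k b M' (none, j) B) := by
  have := isProbabilityMeasure_rate (m := m) (n := n) hh
  have hne : ((some a, j) : Edge m n) ≠ (none, j) := by simp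
  have key := measure_tie_exponential (fun e : Edge m n => expMeasure (rate h e)) hne one_pos hh
    (by simp [rate]) (by simp [rate]) (measurableSet_usesGhost (k := k) b M' a j hB)
  rw [ENNReal.ofReal_one, one_mul] at key
  have hcne : ∀ c : Edge m n → ℝ, Function.Injective (cost c) → c (some a, j) ≠ c (none, j) := by
    intro c hc h
    have := @hc {(some a, j)} {(none, j)} (by simpa [cost] using h)
    simp at this
  have e1 : Uses k b M' (some a, j) B =ᵐ[costLaw m n h]
      {c | c (some a, j) < c (none, j) ∧
        Function.update c (none, j) (c (some a, j)) ∈ UsesGhost k b M' a j B} := by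
    filter_upwards [ae_injective_cost hh] with c hc
    refine propext ?_
    change c ∈ Uses k b M' (some a, j) B ↔ _
    rcases lt_or_gt_of_ne (hcne c hc) with hlt | hgt
    · rw [mem_uses_iff_of_lt hk ha hg hlt]
      exact ⟨fun h => ⟨hlt, h⟩, fun h => h.2⟩
    -- If the ghost edge is the cheaper one, it improves any matching that uses `(a, j)`.
    · refine iff_of_false ?_ fun h => h.1.not_gt hgt
      rintro ⟨-, M, hM, haM, -⟩
      obtain ⟨h1, h2⟩ := hM.1.replace haM (y := none) (Or.inl rfl) (by simp)
      have := hM.2 _ h1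
      rw [h2 c] at this
      linarith
  have e2 : Uses k b M' (none, j) B =ᵐ[costLaw m n h]
      {c | c (none, j) < c (some a, j) ∧
        Function.update c (some a, j) (c (none, j)) ∈ UsesGhost k b M' a j B} := by
    filter_upwards [ae_injective_cost hh] with c hc
    refine propext ?_
    change c ∈ Uses k b M' (none, j) B ↔ _
    rcases lt_or_gt_of_ne (hcne c hc) with hlt | hgt
    · refine iff_of_false ?_ fun h => h.1.not_gt hlt
      rintro ⟨hM', M, hM, hgM, -⟩
      obtain ⟨h1, h2⟩ := hM.1.replace hgM (y := some a)
        (Or.inr (left_notMem_of_ghost_mem hk hc hM' hM ha hg hgM)) (by simp)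
      have := hM.2 _ h1
      rw [h2 c] at this
      linarith
    · rw [mem_uses_ghost_iff_of_lt hk hc ha hg hgt]
      exact ⟨fun h => ⟨hgt, h⟩, fun h => h.2⟩
  rw [measure_congr e1, measure_congr e2]
  exact key

/-- The optimal matchings on the smaller and on the whole graph have `d` and `d'` ghost edges, and
the cost of the latter is in `B`. -/
def jointEvent (k : ℕ) (b : Fin n) (m d d' : ℕ) (B : Set ℝ) : Set (Edge m n → ℝ) :=
  {c | ∃ M' M, IsBest k {b} c M' ∧ IsBest k ∅ c M ∧ ghostCount M' = d ∧ ghostCount M = d' ∧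
    cost c M ∈ B}

theorem measurableSet_jointEvent (b : Fin n) (d d' : ℕ) {B : Set ℝ} (hB : MeasurableSet B) :
    MeasurableSet (jointEvent k b m d d' B) := by
  have : jointEvent k b m d d' B = ⋃ M' : Finset (Edge m n), ⋃ M : Finset (Edge m n),
      {c | IsBest k {b} c M'} ∩ ({c | IsBest k ∅ c M} ∩
        ({c | ghostCount M' = d ∧ ghostCount M = d'} ∩ {c | cost c M ∈ B})) := by
    ext c
    simp only [jointEvent, Set.mem_ofPred_eq, Set.mem_inter_iff, Set.mem_iUnion, and_assoc]
  rw [this]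
  exact MeasurableSet.iUnion fun M' => MeasurableSet.iUnion fun M =>
    (measurableSet_isBest _ M').inter ((measurableSet_isBest _ M).inter
      ((MeasurableSet.const _).inter (measurable_cost M hB)))

theorem IsBest.unique {c : Edge m n → ℝ} (hc : Function.Injective (cost c)) {Z : Finset (Fin n)}
    {M N : Finset (Edge m n)} (hM : IsBest k Z c M) (hN : IsBest k Z c N) : M = N :=
  hc (hM.cost_eq hN)

theorem uses_unique (hk : k ≤ n) {b : Fin n} {c : Edge m n → ℝ} (hc : Function.Injective (cost c))
    {M₁ M₂ : Finset (Edge m n)} {e₁ e₂ : Edge m n} {B : Set ℝ} (h1 : c ∈ Uses k b M₁ e₁ B)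
    (h2 : c ∈ Uses k b M₂ e₂ B) (hn1 : IsNew M₁ e₁) (hn2 : IsNew M₂ e₂) : M₁ = M₂ ∧ e₁ = e₂ := by
  classical
  obtain ⟨hM₁, M, hM, he₁, -⟩ := h1
  obtain ⟨hM₂, N, hN, he₂, -⟩ := h2
  obtain rfl := hM₁.unique hc hM₂
  obtain rfl := hM.unique hc hN
  obtain ⟨e, he, -⟩ := exists_new_edge hk hc hM₁ hM
  have h1 : e₁ ∈ M.filter (IsNew M₁) := Finset.mem_filter.2 ⟨he₁, hn1⟩
  have h2 : e₂ ∈ M.filter (IsNew M₁) := Finset.mem_filter.2 ⟨he₂, hn2⟩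
  rw [he, Finset.mem_singleton] at h1 h2
  exact ⟨rfl, h1.trans h2.symm⟩

/-- Almost surely exactly one pair of an `M'` and a new edge occurs. A new edge never ends at a
right vertex where `M'` has a ghost edge, since `M` keeps that ghost edge; recording this lets
ordinary and ghost new edges range over the same right ends. -/
theorem measure_jointEvent_eq_sum {h : ℝ} (hh : 0 < h) (hk : k ≤ n) (b : Fin n) (d d' : ℕ)
    {B : Set ℝ} (hB : MeasurableSet B) (s : Finset (Finset (Edge m n) × Edge m n))
    (hs : ∀ p, p ∈ s ↔ IsFeasible k {b} p.1 ∧ ghostCount p.1 = d ∧ IsNew p.1 p.2 ∧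
      (none, p.2.2) ∉ p.1 ∧ d' = d + if p.2.1 = none then 1 else 0) :
    costLaw m n h (jointEvent k b m d d' B) =
      ∑ p ∈ s, costLaw m n h (Uses k b p.1 p.2 B) := by
  classical
  rw [← measure_biUnion_finset₀ (f := fun p : Finset (Edge m n) × Edge m n => Uses k b p.1 p.2 B)]
  · refine measure_congr ?_
    filter_upwards [ae_injective_cost hh] with c hc
    refine propext ?_
    change c ∈ jointEvent k b m d d' B ↔ c ∈ ⋃ p ∈ s, Uses k b p.1 p.2 B
    simp only [Set.mem_iUnion]
    constructor
    · rintro ⟨M', M, hM', hM, h1, h2, hcB⟩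
      obtain ⟨e, he, hcount⟩ := exists_new_edge hk hc hM' hM
      obtain ⟨heM, hnew⟩ := Finset.mem_filter.1 (he.symm ▸ Finset.mem_singleton_self e)
      refine ⟨(M', e), (hs _).2 ⟨hM'.1, h1, hnew, fun hg => ?_, ?_⟩, hM', M, hM, heM, hcB⟩
      · have hgM := mem_of_isBest hk hc hM' hM hg (Or.inl rfl)
        have : e = (none, e.2) := hM.1.1.1 _ heM _ hgM rfl
        refine hnew.1 (congrArg Prod.fst this) ?_
        rw [this]
        exact hg
      · rw [← h1, ← h2, hcount]
    · rintro ⟨⟨M', e⟩, hp, hM', M, hM, heM, hcB⟩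
      obtain ⟨-, h1, hnew, -, h2⟩ := (hs _).1 hp
      obtain ⟨e', he', hcount⟩ := exists_new_edge hk hc hM' hM
      have : e ∈ M.filter (IsNew M') := Finset.mem_filter.2 ⟨heM, hnew⟩
      rw [he', Finset.mem_singleton] at this
      subst this
      exact ⟨M', M, hM', hM, h1, by rw [hcount, h1, h2], hcB⟩
  · intro p hp q hq hpq
    rw [Function.onFun, AEDisjoint, ← nonpos_iff_eq_zero]
    refine le_of_le_of_eq (measure_mono fun c hc => ?_) (ae_iff.1 (ae_injective_cost hh))
    intro hinj
    obtain ⟨h1, h2⟩ := uses_unique hk hinj hc.1 hc.2 ((hs _).1 hp).2.2.1 ((hs _).1 hq).2.2.1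
    exact hpq (Prod.ext h1 h2)
  · exact fun p _ => (measurableSet_uses b p.1 p.2 hB).nullMeasurableSet

/-- For each `M'` and each right end `j`, every one of the `m - k + d + 1` unused left vertices
contributes `1 / h` times as much as the ghost edge at `j`. -/
theorem measure_jointEvent {h : ℝ} (hh : 0 < h) (hk : k ≤ n) (hkm : k ≤ m) (b : Fin n) (d : ℕ)
    {B : Set ℝ} (hB : MeasurableSet B) :
    ENNReal.ofReal h * costLaw m n h (jointEvent k b m d d B) =
      ((m - k + d + 1 : ℕ) : ENNReal) * costLaw m n h (jointEvent k b m d (d + 1) B) := by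
  classical
  let I : Finset (Finset (Edge m n) × Fin n) := Finset.univ.filter fun p =>
    IsFeasible k {b} p.1 ∧ ghostCount p.1 = d ∧ (none, p.2) ∉ p.1
  let U : Finset (Edge m n) → Finset (Fin m) := fun M => Finset.univ.filter fun a =>
    ∀ i, (some a, i) ∉ M
  have h2 : costLaw m n h (jointEvent k b m d (d + 1) B) =
      ∑ p ∈ I, costLaw m n h (Uses k b p.1 (none, p.2) B) := by
    rw [measure_jointEvent_eq_sum hh hk b d (d + 1) hB
      (I.image fun p => (p.1, (none, p.2))), Finset.sum_image]
    · rintro p - q - h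
      simpa [Prod.ext_iff] using h
    · rintro ⟨M, x, j⟩
      simp only [I, Finset.mem_image, Finset.mem_filter, Finset.mem_univ, true_and, Prod.exists,
        Prod.mk.injEq, IsNew]
      constructor
      · rintro ⟨M, j, ⟨h1, h2, h3⟩, rfl, rfl, rfl⟩
        simp [h1, h2, h3]
      · rintro ⟨h1, h2, h3, h4, h5⟩
        have : x = none := by
          by_contra hx
          simp [hx] at h5
        subst this
        exact ⟨M, j, ⟨h1, h2, h4⟩, rfl, rfl, rfl⟩
  have h1 : costLaw m n h (jointEvent k b m d d B) =
      ∑ p ∈ I, ∑ a ∈ U p.1, costLaw m n h (Uses k b p.1 (some a, p.2) B) := by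
    rw [Finset.sum_sigma', measure_jointEvent_eq_sum hh hk b d d hB
      ((I.sigma fun p => U p.1).image fun q => (q.1.1, (some q.2, q.1.2))), Finset.sum_image]
    · rintro ⟨⟨M, j⟩, a⟩ - ⟨⟨M', j'⟩, a'⟩ - h
      simp only [Prod.mk.injEq, Option.some.injEq] at h
      obtain ⟨rfl, rfl, rfl⟩ := h
      rfl
    · rintro ⟨M, x, j⟩
      simp only [I, U, Finset.mem_image, Finset.mem_sigma, Finset.mem_filter, Finset.mem_univ,
        true_and, Sigma.exists, Prod.exists, Prod.mk.injEq, IsNew]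
      constructor
      · rintro ⟨M, j, a, ⟨⟨h1, h2, h3⟩, h4⟩, rfl, rfl, rfl⟩
        simp [h1, h2, h3, h4]
      · rintro ⟨h1, h2, h3, h4, h5⟩
        rcases x with _ | a
        · simp at h5
        · exact ⟨M, j, a, ⟨⟨h1, h2, h4⟩, h3.2 (by simp)⟩, rfl, rfl, rfl⟩
  rw [h1, h2, Finset.mul_sum, Finset.mul_sum]
  refine Finset.sum_congr rfl fun p hp => ?_
  obtain ⟨hp1, hp2, hp3⟩ := (Finset.mem_filter.1 hp).2
  rw [Finset.mul_sum, Finset.sum_congr rfl fun a ha =>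
    measure_uses hh hk b (Finset.mem_filter.1 ha).2 hp3 hB, Finset.sum_const, nsmul_eq_mul]
  congr 2
  have hcard : (U p.1).card + k = m + ghostCount p.1 + ({b} : Finset (Fin n)).card := by
    convert card_unused_left hp1
  rw [hp2, Finset.card_singleton] at hcard
  change (U p.1).card = m - k + d + 1
  omega

/-! ### Relabelling right vertices: the smaller graph, and symmetry. -/

section Relabel

variable {n' : ℕ} {s : Fin n → Fin n'}

/-- Relabelling the right vertices. -/
def relabel (s : Fin n → Fin n') (e : Edge m n) : Edge m n' := (e.1, s e.2)

theorem relabel_injective (hs : Function.Injective s) :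
    Function.Injective (relabel (m := m) s) := fun e f h => by
  simp only [relabel, Prod.mk.injEq] at h
  exact Prod.ext h.1 (hs h.2)

theorem isMatching_image_iff (hs : Function.Injective s) {L : Finset (Edge m n)} :
    IsMatching (L.image (relabel s)) ↔ IsMatching L := by
  have hinj := relabel_injective (m := m) hs
  simp only [IsMatching, Finset.forall_mem_image, hinj.eq_iff]
  simp only [relabel, hs.eq_iff]

theorem cost_image (hs : Function.Injective s) (c : Edge m n' → ℝ) (L : Finset (Edge m n)) :
    cost c (L.image (relabel s)) = cost (fun e => c (relabel s e)) L :=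
  Finset.sum_image fun _ _ _ _ h => relabel_injective hs h

theorem ghostCount_image (hs : Function.Injective s) (L : Finset (Edge m n)) :
    ghostCount (L.image (relabel s)) = ghostCount L := by
  rw [ghostCount, Finset.filter_image, Finset.card_image_of_injective _ (relabel_injective hs)]
  rfl

theorem exists_image_eq {M : Finset (Edge m n')} (hM : ∀ e ∈ M, ∃ j, s j = e.2) :
    ∃ L : Finset (Edge m n), L.image (relabel s) = M := by
  classical
  refine ⟨Finset.univ.filter fun e => relabel s e ∈ M, ?_⟩
  ext e
  simp only [Finset.mem_image, Finset.mem_filter, Finset.mem_univ, true_and]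
  constructor
  · rintro ⟨f, hf, rfl⟩
    exact hf
  · intro he
    obtain ⟨j, hj⟩ := hM e he
    have : relabel s (e.1, j) = e := Prod.ext rfl hj
    exact ⟨(e.1, j), this.symm ▸ he, this⟩

/-- This serves two purposes: for `Fin.succ` the omitted vertex `0` is the forbidden one, which
identifies the smaller graph; for permutations, where `Z = ∅`, it gives the symmetry between right
vertices. -/
theorem isBest_image_iff (hs : Function.Injective s) {K : ℕ} {Z : Finset (Fin n')}
    (hK : K + Z.card = k) (hZ : ∀ j, j ∈ Z ↔ ∀ i, s i ≠ j) {c : Edge m n' → ℝ}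
    {L : Finset (Edge m n)} :
    IsBest k Z c (L.image (relabel s)) ↔ IsBest K ∅ (fun e => c (relabel s e)) L := by
  have hfeas : ∀ L : Finset (Edge m n), IsFeasible k Z (L.image (relabel s)) ↔
      IsFeasible K ∅ L := by
    intro L
    have h1 : ∀ e ∈ L.image (relabel s), e.2 ∉ Z := by
      simp only [Finset.forall_mem_image]
      intro e _ h
      exact (hZ _).1 h e.2 rfl
    rw [IsFeasible, IsFeasible, isMatching_image_iff hs,
      Finset.card_image_of_injective _ (relabel_injective hs)]
    simp only [implies_true, true_and, Finset.notMem_empty, not_false_eq_true,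
      Finset.card_empty, add_zero, ← hK, Nat.add_right_cancel_iff]
    tauto
  rw [IsBest, IsBest, hfeas]
  refine and_congr_right fun _ => ⟨fun h N hN => ?_, fun h N hN => ?_⟩
  · rw [← cost_image hs, ← cost_image hs]
    exact h _ ((hfeas N).2 hN)
  · obtain ⟨N, rfl⟩ := exists_image_eq (s := s) (M := N) fun e he => by
      by_contra hcon
      exact hN.2.1 e he ((hZ _).2 fun i hi => hcon ⟨i, hi⟩)
    rw [cost_image hs, cost_image hs]
    exact h _ ((hfeas N).1 hN)

theorem IsBest.exists_image {Z : Finset (Fin n')} (hZ : ∀ j, j ∈ Z ↔ ∀ i, s i ≠ j)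
    {c : Edge m n' → ℝ} {M : Finset (Edge m n')} (hM : IsBest k Z c M) :
    ∃ L : Finset (Edge m n), L.image (relabel s) = M :=
  exists_image_eq fun e he => by
    by_contra hcon
    exact hM.1.2.1 e he ((hZ _).2 fun i hi => hcon ⟨i, hi⟩)

end Relabel

/-- The optimal matching on the smaller graph has `d` ghost edges. -/
def smallEvent (k : ℕ) (b : Fin n) (m d : ℕ) : Set (Edge m n → ℝ) :=
  {c | ∃ M', IsBest k {b} c M' ∧ ghostCount M' = d}

theorem mem_singleton_zero_iff (j : Fin (n + 1)) :
    j ∈ ({0} : Finset (Fin (n + 1))) ↔ ∀ i : Fin n, i.succ ≠ j := by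
  rw [Finset.mem_singleton]
  constructor
  · rintro rfl i
    exact Fin.succ_ne_zero i
  · intro h
    by_contra hj
    obtain ⟨i, rfl⟩ := Fin.exists_succ_eq.2 hj
    exact h i rfl

theorem mem_smallEvent_iff {d : ℕ} {c : Edge m (n + 1) → ℝ} :
    c ∈ smallEvent (k + 1) 0 m d ↔ (fun e => c (relabel Fin.succ e)) ∈ ghostEvent k m n d := by
  have hiff := fun L : Finset (Edge m n) => isBest_image_iff (m := m) (K := k) (k := k + 1)
    (Fin.succ_injective n) (Z := {0}) (by simp) mem_singleton_zero_iff (c := c) (L := L)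
  rw [mem_ghostEvent]
  constructor
  · rintro ⟨M', hM', hd⟩
    obtain ⟨L, rfl⟩ := hM'.exists_image mem_singleton_zero_iff
    exact ⟨L, (hiff L).1 hM', by rwa [ghostCount_image (Fin.succ_injective n)] at hd⟩
  · rintro ⟨L, hL, hd⟩
    exact ⟨_, (hiff L).2 hL, by rwa [ghostCount_image (Fin.succ_injective n)]⟩

theorem IsBest.minCost_relabel {c : Edge m (n + 1) → ℝ} {M' : Finset (Edge m (n + 1))}
    (hM' : IsBest (k + 1) {0} c M') : minCost k (fun e => c (relabel Fin.succ e)) = cost c M' := by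
  obtain ⟨L, rfl⟩ := hM'.exists_image mem_singleton_zero_iff
  rw [cost_image (Fin.succ_injective n)]
  exact ((isBest_image_iff (Fin.succ_injective n) (by simp) mem_singleton_zero_iff).1
    hM').minCost_eq

/-! ### The minimum cost and the ghost edge at `b`. -/

theorem IsFeasible.insert_ghost {b : Fin n} {M' : Finset (Edge m n)} (hM' : IsFeasible k {b} M') :
    IsFeasible k ∅ (insert (none, b) M') ∧ (none, b) ∉ M' := by
  obtain ⟨⟨h1, h2⟩, h3, h4⟩ := hM'
  have hb : ∀ e ∈ M', e.2 ≠ b := fun e he h => h3 e he (Finset.mem_singleton.2 h)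
  have hnot : ((none, b) : Edge m n) ∉ M' := fun h => hb _ h rfl
  refine ⟨⟨⟨?_, ?_⟩, by simp, ?_⟩, hnot⟩
  · intro e he f hf h
    rcases Finset.mem_insert.1 he with rfl | he <;> rcases Finset.mem_insert.1 hf with rfl | hf
    · rfl
    · exact absurd h.symm (hb f hf)
    · exact absurd h (hb e he)
    · exact h1 e he f hf h
  · intro e he f hf h0 h
    rcases Finset.mem_insert.1 he with rfl | he <;> rcases Finset.mem_insert.1 hf with rfl | hf
    · rfl
    · exact absurd rfl h0
    · exact absurd h h0
    · exact h2 e he f hf h0 h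
  · rw [Finset.card_insert_of_notMem hnot, Finset.card_empty]
    simpa using h4

theorem IsFeasible.erase {M : Finset (Edge m n)} (hM : IsFeasible k ∅ M) {e : Edge m n}
    (he : e ∈ M) : IsFeasible k {e.2} (M.erase e) := by
  obtain ⟨⟨h1, h2⟩, -, h4⟩ := hM
  refine ⟨⟨fun f hf f' hf' => h1 f (Finset.mem_of_mem_erase hf) f' (Finset.mem_of_mem_erase hf'),
    fun f hf f' hf' => h2 f (Finset.mem_of_mem_erase hf) f' (Finset.mem_of_mem_erase hf')⟩,
    fun f hf h => ?_, ?_⟩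
  · exact (Finset.mem_erase.1 hf).1 (h1 f (Finset.mem_of_mem_erase hf) e he
      (Finset.mem_singleton.1 h))
  · rw [Finset.card_singleton, Finset.card_erase_add_one he]
    simpa using h4

theorem cost_erase {c : Edge m n → ℝ} {M : Finset (Edge m n)} {e : Edge m n} (he : e ∈ M) :
    cost c (M.erase e) = cost c M - c e := by
  unfold cost
  rw [← Finset.add_sum_erase M c he]
  ring

theorem cost_insert {c : Edge m n → ℝ} {M : Finset (Edge m n)} {e : Edge m n} (he : e ∉ M) :
    cost c (insert e M) = c e + cost c M := by
  unfold cost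
  rw [Finset.sum_insert he]

theorem exists_ordinary_matching (hkm : k ≤ m) (hkn : k ≤ n) (b : Fin n) :
    ∃ M : Finset (Edge m n), IsFeasible k ∅ M ∧ (none, b) ∉ M := by
  refine ⟨Finset.univ.image fun i : Fin k => (some (Fin.castLE hkm i), Fin.castLE hkn i),
    ⟨⟨?_, ?_⟩, by simp, ?_⟩, by simp⟩
  · simp only [Finset.mem_image, Finset.mem_univ, true_and]
    rintro _ ⟨i, rfl⟩ _ ⟨j, rfl⟩ h
    simpa using h
  · simp only [Finset.mem_image, Finset.mem_univ, true_and]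
    rintro _ ⟨i, rfl⟩ _ ⟨j, rfl⟩ - h
    simpa using h
  · rw [Finset.card_image_of_injective _ fun i j h => by simpa using h]
    simp

/-- The minimum cost as a function of the cost of the ghost edge at `b`. -/
theorem exists_threshold (hk : 1 ≤ k) (hkm : k ≤ m) (hkn : k ≤ n) (b : Fin n)
    {c : Edge m n → ℝ} (hc : ∀ e, 0 ≤ c e) {M' : Finset (Edge m n)} (hM' : IsBest k {b} c M') :
    ∃ T, 0 ≤ T ∧ ∀ x, minCost k (Function.update c (none, b) x) = cost c M' + min x T := by
  classical
  obtain ⟨M₀, hM₀, hb₀⟩ := exists_ordinary_matching hkm hkn b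
  -- `N` is a cheapest `k`-matching without the ghost edge at `b`, and `T` is its excess over `M'`.
  -- The alternative is to add that ghost edge to `M'`.
  obtain ⟨N, hN, hmin⟩ := (Finset.univ.filter fun M : Finset (Edge m n) =>
    IsFeasible k ∅ M ∧ (none, b) ∉ M).exists_min_image (cost c) ⟨M₀, by simp [hM₀, hb₀]⟩
  simp only [Finset.mem_filter, Finset.mem_univ, true_and] at hN hmin
  obtain ⟨hN, hbN⟩ := hN
  have hnot := hM'.1.insert_ghost.2
  -- Deleting the edge of `N` at `b`, or any edge if there is none, gives a competitor of `M'` that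
  -- costs no more than `N`.
  have hT : cost c M' ≤ cost c N := by
    by_cases h : ∃ e ∈ N, e.2 = b
    · obtain ⟨e, he, rfl⟩ := h
      have := hM'.2 _ (hN.erase he)
      rw [cost_erase he] at this
      linarith [hc e]
    · have hcard : N.card = k := by simpa using hN.2.2
      obtain ⟨e, he⟩ : N.Nonempty := Finset.card_pos.1 (by omega)
      have hf : IsFeasible k {b} (N.erase e) := by
        refine ⟨(hN.erase he).1, fun f hf hfb => h ⟨f, Finset.mem_of_mem_erase hf,
          Finset.mem_singleton.1 hfb⟩, ?_⟩
        rw [Finset.card_singleton, Finset.card_erase_add_one he, hcard]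
      have := hM'.2 _ hf
      rw [cost_erase he] at this
      linarith [hc e]
  refine ⟨cost c N - cost c M', sub_nonneg.2 hT, fun x => ?_⟩
  have hi : cost (Function.update c (none, b) x) (insert (none, b) M') = x + cost c M' := by
    rw [cost_insert hnot, Function.update_self, cost_update_of_notMem hnot]
  have hlow : ∀ L, IsFeasible k ∅ L →
      cost c M' + min x (cost c N - cost c M') ≤ cost (Function.update c (none, b) x) L := by
    intro L hL
    by_cases hbL : (none, b) ∈ L
    · rw [cost_update_of_mem hbL]
      have := hM'.2 _ (hL.erase hbL)
      rw [cost_erase hbL] at this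
      linarith [min_le_left x (cost c N - cost c M')]
    · rw [cost_update_of_notMem hbL]
      linarith [min_le_right x (cost c N - cost c M'), hmin L ⟨hL, hbL⟩]
  rcases le_total x (cost c N - cost c M') with h | h
  · rw [min_eq_left h] at hlow ⊢
    have : IsBest k ∅ (Function.update c (none, b) x) (insert (none, b) M') :=
      ⟨hM'.1.insert_ghost.1, fun L hL => by
        rw [hi]
        linarith [hlow L hL]⟩
    rw [this.minCost_eq, hi, add_comm]
  · rw [min_eq_right h] at hlow ⊢
    have : IsBest k ∅ (Function.update c (none, b) x) N :=
      ⟨hN, fun L hL => by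
        rw [cost_update_of_notMem hbN]
        linarith [hlow L hL]⟩
    rw [this.minCost_eq, cost_update_of_notMem hbN]
    ring

/-! ### Expectations over the events of the optimal matchings. -/

/-- The exponential of the minimum cost. -/
noncomputable def expCost (k : ℕ) (t : ℂ) (c : Edge m n → ℝ) : ℂ :=
  Complex.exp (t * (minCost k c : ℂ))

theorem measurable_expCost (hk : k ≤ n) (t : ℂ) : Measurable (expCost (m := m) (n := n) k t) := by
  have := measurable_minCost (m := m) hk
  unfold expCost
  fun_prop

/-- Some optimal matching has `d` ghost edges, one of which is at `j`. -/
def ghostAt (k m : ℕ) (d : ℕ) (j : Fin n) : Set (Edge m n → ℝ) :=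
  {c | ∃ M, IsBest k ∅ c M ∧ ghostCount M = d ∧ (none, j) ∈ M}

theorem measurableSet_ghostAt (d : ℕ) (j : Fin n) : MeasurableSet (ghostAt k m d j) := by
  have : ghostAt k m d j =
      ⋃ M : Finset (Edge m n), {c | IsBest k ∅ c M} ∩ {c | ghostCount M = d ∧ (none, j) ∈ M} := by
    ext c
    simp [ghostAt]
  rw [this]
  exact MeasurableSet.iUnion fun M => (measurableSet_isBest _ M).inter (MeasurableSet.const _)

theorem measurableSet_smallEvent (b : Fin n) (d : ℕ) : MeasurableSet (smallEvent k b m d) := by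
  have : smallEvent k b m d =
      ⋃ M : Finset (Edge m n), {c | IsBest k {b} c M} ∩ {c | ghostCount M = d} := by
    ext c
    simp [smallEvent]
  rw [this]
  exact MeasurableSet.iUnion fun M => (measurableSet_isBest _ M).inter (MeasurableSet.const _)

theorem isBest_relabel_iff (σ : Equiv.Perm (Fin n)) {c : Edge m n → ℝ}
    {M : Finset (Edge m n)} :
    IsBest k ∅ c (M.image (relabel σ)) ↔ IsBest k ∅ (fun e => c (relabel σ e)) M :=
  isBest_image_iff σ.injective (by simp) fun j => by
    simp only [Finset.notMem_empty, false_iff, not_forall, not_not]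
    exact ⟨σ.symm j, by simp⟩

theorem setIntegral_ghostAt_eq {h : ℝ} (hh : 0 < h) (hk : k ≤ n) (d : ℕ) (t : ℂ) (i j : Fin n) :
    ∫ c in ghostAt k m d i, expCost k t c ∂costLaw m n h =
      ∫ c in ghostAt k m d j, expCost k t c ∂costLaw m n h := by
  have := isProbabilityMeasure_rate (m := m) (n := n) hh
  set σ := Equiv.swap i j with hσ
  have hp : MeasurePreserving (fun (c : Edge m n → ℝ) e => c (relabel σ e))
      (costLaw m n h) (costLaw m n h) :=
    measurePreserving_comp (fun e : Edge m n => expMeasure (rate h e)) (relabel_injective σ.injective)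
  have hm := (measurable_expCost (m := m) hk t).indicator (measurableSet_ghostAt (k := k) (m := m) d i)
  rw [← integral_indicator (measurableSet_ghostAt d i), ← integral_indicator (measurableSet_ghostAt d j),
    ← hp.map_eq, integral_map hp.measurable.aemeasurable
      (hm.aestronglyMeasurable), hp.map_eq]
  refine integral_congr_ae (ae_of_all _ fun c => ?_)
  have e1 : (fun e => c (relabel σ e)) ∈ ghostAt k m d i ↔ c ∈ ghostAt k m d j := by
    constructor
    · rintro ⟨M, hM, hd, hi⟩
      refine ⟨_, (isBest_relabel_iff σ).2 hM, by rwa [ghostCount_image σ.injective],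
        Finset.mem_image.2 ⟨_, hi, ?_⟩⟩
      simp [relabel, hσ]
    · rintro ⟨M, hM, hd, hi⟩
      obtain ⟨L, rfl⟩ := hM.exists_image (s := σ) fun j => by
        simp only [Finset.notMem_empty, false_iff, not_forall, not_not]
        exact ⟨σ.symm j, by simp⟩
      rw [ghostCount_image σ.injective] at hd
      refine ⟨L, (isBest_relabel_iff σ).1 hM, hd, ?_⟩
      obtain ⟨e, he, he'⟩ := Finset.mem_image.1 hi
      have : e = (none, i) := relabel_injective σ.injective (he'.trans (by simp [relabel, hσ]))
      rwa [← this]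
  have e2 : expCost k t (fun e => c (relabel σ e)) = expCost k t c := by
    obtain ⟨M, hM⟩ := exists_isBest (c := fun e => c (relabel σ e))
      (exists_isFeasible (m := m) (Z := ∅) (by simp) hk)
    rw [expCost, expCost, hM.minCost_eq, ((isBest_relabel_iff σ).2 hM).minCost_eq,
      cost_image σ.injective]
  dsimp only
  by_cases hcj : c ∈ ghostAt k m d j
  · rw [Set.indicator_of_mem hcj, Set.indicator_of_mem (e1.2 hcj), e2]
  · rw [Set.indicator_of_notMem hcj, Set.indicator_of_notMem fun h => hcj (e1.1 h)]

theorem integral_ghostVariable (d : ℕ) (t : ℂ) (h : ℝ) :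
    ∫ c, ghostVariable k m n d t c ∂costLaw m n h =
      ∫ c in ghostEvent k m n d, expCost k t c ∂costLaw m n h :=
  integral_indicator (measurableSet_ghostEvent d)

theorem integrable_ghostVariable_iff (d : ℕ) (t : ℂ) (h : ℝ) :
    Integrable (ghostVariable k m n d t) (costLaw m n h) ↔
      IntegrableOn (expCost k t) (ghostEvent k m n d) (costLaw m n h) :=
  integrable_indicator_iff (measurableSet_ghostEvent d)

theorem ghostAt_subset (d : ℕ) (j : Fin n) : ghostAt k m d j ⊆ ghostEvent k m n d := by
  rintro c ⟨M, hM, hd, -⟩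
  exact mem_ghostEvent.2 ⟨M, hM, hd⟩

/-- An optimal matching with `d` ghost edges has them at `d` right vertices, so the indicators of
`ghostAt` sum to `d` times that of `ghostEvent`. By symmetry the `n` summands have equal integrals.
-/
theorem setIntegral_ghostAt {h : ℝ} (hh : 0 < h) (hk : k ≤ n) (d : ℕ) (t : ℂ) (j : Fin n)
    (hint : IntegrableOn (expCost k t) (ghostEvent k m n d) (costLaw m n h)) :
    n * ∫ c in ghostAt k m d j, expCost k t c ∂costLaw m n h =
      d * ∫ c in ghostEvent k m n d, expCost k t c ∂costLaw m n h := by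
  classical
  have h1 : ∑ i, ∫ c in ghostAt k m d i, expCost k t c ∂costLaw m n h =
      n * ∫ c in ghostAt k m d j, expCost k t c ∂costLaw m n h := by
    rw [Finset.sum_congr rfl fun i _ => setIntegral_ghostAt_eq hh hk d t i j, Finset.sum_const]
    simp
  rw [← h1, ← integral_indicator (measurableSet_ghostEvent d), ← integral_const_mul,
    Finset.sum_congr rfl fun i _ => (integral_indicator (measurableSet_ghostAt d i)).symm,
    ← integral_finsetSum]
  · refine integral_congr_ae ?_
    filter_upwards [ae_injective_cost hh] with c hc
    obtain ⟨M, hM⟩ := exists_isBest (c := c) (exists_isFeasible (m := m) (Z := ∅) (by simp) hk)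
    have e1 : ∀ i, c ∈ ghostAt k m d i ↔ ghostCount M = d ∧ (none, i) ∈ M := by
      intro i
      constructor
      · rintro ⟨N, hN, h⟩
        rwa [hM.unique hc hN]
      · exact fun h => ⟨M, hM, h⟩
    have e2 : c ∈ ghostEvent k m n d ↔ ghostCount M = d := by
      rw [mem_ghostEvent]
      constructor
      · rintro ⟨N, hN, h⟩
        rwa [hM.unique hc hN]
      · exact fun h => ⟨M, hM, h⟩
    by_cases hd : ghostCount M = d
    · simp only [Set.indicator, e1, e2, hd, true_and, if_true]
      rw [← Finset.sum_filter, Finset.sum_const, nsmul_eq_mul]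
      congr 2
      rw [← hd, ghostCount]
      refine Finset.card_bij (fun i _ => (none, i)) ?_ ?_ ?_
      · intro i hi
        simpa using hi
      · intro i _ j _ hij
        simpa using hij
      · rintro ⟨x, i⟩ hi
        obtain ⟨h1, h2⟩ := Finset.mem_filter.1 hi
        dsimp only at h2
        subst h2
        exact ⟨i, by simpa using h1, rfl⟩
    · simp [Set.indicator, e1, e2, hd]
  · exact fun i _ => (integrable_indicator_iff (measurableSet_ghostAt d i)).2
      (hint.mono_set (ghostAt_subset d i))

/-- Because `measure_jointEvent` holds for every measurable set of costs, it is an identity between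
laws of the minimum cost. It therefore transfers both integrability and integrals of `exp(tC)`. -/
theorem smul_map_jointEvent {h : ℝ} (hh : 0 < h) (hk : k ≤ n) (hkm : k ≤ m) (b : Fin n) (d : ℕ) :
    ENNReal.ofReal h • ((costLaw m n h).restrict (jointEvent k b m d d Set.univ)).map (minCost k) =
      ((m - k + d + 1 : ℕ) : ENNReal) •
        ((costLaw m n h).restrict (jointEvent k b m d (d + 1) Set.univ)).map (minCost k) := by
  have hm := measurable_minCost (m := m) hk
  ext B hB
  have hpre : ∀ d', (minCost k : (Edge m n → ℝ) → ℝ) ⁻¹' B ∩ jointEvent k b m d d' Set.univ =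
      jointEvent k b m d d' B := by
    intro d'
    ext c
    constructor
    · rintro ⟨hB, M', M, hM', hM, h1, h2, -⟩
      exact ⟨M', M, hM', hM, h1, h2, hM.minCost_eq ▸ hB⟩
    · rintro ⟨M', M, hM', hM, h1, h2, hB⟩
      exact ⟨by rwa [Set.mem_preimage, hM.minCost_eq], M', M, hM', hM, h1, h2, trivial⟩
  simp only [Measure.smul_apply, Measure.map_apply hm hB, Measure.restrict_apply (hm hB), hpre,
    smul_eq_mul]
  exact measure_jointEvent hh hk hkm b d hB

section Joint

variable {h : ℝ} (hh : 0 < h) (hk : k ≤ n) (hkm : k ≤ m) (b : Fin n) (d : ℕ) (t : ℂ)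
include hh

include hk hkm in
theorem integrableOn_jointEvent_iff :
    IntegrableOn (expCost k t) (jointEvent k b m d d Set.univ) (costLaw m n h) ↔
      IntegrableOn (expCost k t) (jointEvent k b m d (d + 1) Set.univ) (costLaw m n h) := by
  have hm := measurable_minCost (m := m) hk
  have hg : Measurable fun x : ℝ => Complex.exp (t * x) := by fun_prop
  have hiff : ∀ X, IntegrableOn (expCost k t) X (costLaw m n h) ↔
      Integrable (fun x : ℝ => Complex.exp (t * x))
        (((costLaw m n h).restrict X).map (minCost k)) := fun X =>
    (integrable_map_measure hg.aestronglyMeasurable hm.aemeasurable).symm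
  rw [hiff, hiff, ← integrable_smul_measure (c := ENNReal.ofReal h) (by simpa using hh)
    ENNReal.ofReal_ne_top, smul_map_jointEvent hh hk hkm,
    integrable_smul_measure (by simp) (ENNReal.natCast_ne_top _)]

include hk hkm in
theorem setIntegral_jointEvent :
    h * ∫ c in jointEvent k b m d d Set.univ, expCost k t c ∂costLaw m n h =
      (m - k + d + 1 : ℂ) *
        ∫ c in jointEvent k b m d (d + 1) Set.univ, expCost k t c ∂costLaw m n h := by
  have hm := measurable_minCost (m := m) hk
  have hg : Measurable fun x : ℝ => Complex.exp (t * x) := by fun_prop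
  have hmap : ∀ X, ∫ c in X, expCost k t c ∂costLaw m n h =
      ∫ x, Complex.exp (t * (x : ℝ)) ∂((costLaw m n h).restrict X).map (minCost k) := fun X =>
    (integral_map hm.aemeasurable hg.aestronglyMeasurable).symm
  have key := congrArg (fun ν : Measure ℝ => ∫ x, Complex.exp (t * (x : ℝ)) ∂ν)
    (smul_map_jointEvent hh hk hkm b d)
  simp only [integral_smul_measure] at key
  rw [hmap, hmap]
  rw [ENNReal.toReal_ofReal hh.le, ENNReal.toReal_natCast] at key
  simpa [Nat.cast_sub hkm] using key

theorem aedisjoint_jointEvent {d₁ d₂ e₁ e₂ : ℕ} (hne : (d₁, e₁) ≠ (d₂, e₂)) :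
    AEDisjoint (costLaw m n h) (jointEvent k b m d₁ e₁ Set.univ)
      (jointEvent k b m d₂ e₂ Set.univ) := by
  rw [AEDisjoint, ← nonpos_iff_eq_zero]
  refine le_of_le_of_eq (measure_mono fun c hc => ?_) (ae_iff.1 (ae_injective_cost hh))
  intro hinj
  obtain ⟨⟨M', M, hM', hM, rfl, rfl, -⟩, ⟨N', N, hN', hN, rfl, rfl, -⟩⟩ := hc
  rw [hM'.unique hinj hN', hM.unique hinj hN] at hne
  exact hne rfl

include hk in
theorem smallEvent_ae_eq : smallEvent k b m d =ᵐ[costLaw m n h]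
    (jointEvent k b m d d Set.univ ∪ jointEvent k b m d (d + 1) Set.univ : Set _) := by
  classical
  filter_upwards [ae_injective_cost hh] with c hc
  refine propext ?_
  change c ∈ smallEvent k b m d ↔ c ∈ jointEvent k b m d d Set.univ ∪ jointEvent k b m d (d + 1) Set.univ
  obtain ⟨M, hM⟩ := exists_isBest (c := c) (exists_isFeasible (m := m) (Z := ∅) (by simp) hk)
  constructor
  · rintro ⟨M', hM', hd⟩
    obtain ⟨e, -, he⟩ := exists_new_edge hk hc hM' hM
    split_ifs at he
    · exact Or.inr ⟨M', M, hM', hM, hd, by omega, trivial⟩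
    · exact Or.inl ⟨M', M, hM', hM, hd, by omega, trivial⟩
  · rintro (⟨M', M, hM', hM, hd, -⟩ | ⟨M', M, hM', hM, hd, -⟩)
    · exact ⟨M', hM', hd⟩
    · exact ⟨M', hM', hd⟩

include hk in
-- Restoring `b` never lowers the number of ghost edges, so `M'` has none if `M` has none.
theorem ghostEvent_zero_ae_eq (hk1 : 1 ≤ k) : ghostEvent k m n 0 =ᵐ[costLaw m n h]
    jointEvent k b m 0 0 Set.univ := by
  classical
  filter_upwards [ae_injective_cost hh] with c hc
  refine propext ?_
  change c ∈ ghostEvent k m n 0 ↔ c ∈ jointEvent k b m 0 0 Set.univ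
  rw [mem_ghostEvent]
  obtain ⟨M', hM'⟩ := exists_isBest (c := c) (exists_isFeasible (m := m) (Z := {b}) (by simpa) hk)
  constructor
  · rintro ⟨M, hM, hd⟩
    obtain ⟨e, -, he⟩ := exists_new_edge hk hc hM' hM
    exact ⟨M', M, hM', hM, by omega, hd, trivial⟩
  · rintro ⟨M', M, hM', hM, -, hd, -⟩
    exact ⟨M, hM, hd⟩

include hk in
theorem ghostEvent_succ_ae_eq (hk1 : 1 ≤ k) : ghostEvent k m n (d + 1) =ᵐ[costLaw m n h]
    (jointEvent k b m (d + 1) (d + 1) Set.univ ∪ jointEvent k b m d (d + 1) Set.univ : Set _) := by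
  classical
  filter_upwards [ae_injective_cost hh] with c hc
  refine propext ?_
  change c ∈ ghostEvent k m n (d + 1) ↔
    c ∈ jointEvent k b m (d + 1) (d + 1) Set.univ ∪ jointEvent k b m d (d + 1) Set.univ
  rw [mem_ghostEvent]
  obtain ⟨M', hM'⟩ := exists_isBest (c := c) (exists_isFeasible (m := m) (Z := {b}) (by simpa) hk)
  constructor
  · rintro ⟨M, hM, hd⟩
    obtain ⟨e, -, he⟩ := exists_new_edge hk hc hM' hM
    split_ifs at he
    · exact Or.inr ⟨M', M, hM', hM, by omega, hd, trivial⟩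
    · exact Or.inl ⟨M', M, hM', hM, by omega, hd, trivial⟩
  · rintro (⟨M', M, hM', hM, -, hd, -⟩ | ⟨M', M, hM', hM, -, hd, -⟩)
    · exact ⟨M, hM, hd⟩
    · exact ⟨M, hM, hd⟩

end Joint

/-- Deleting or inserting the ghost edge at `0` translates between the two matching problems. So
this edge is used exactly when the minimum costs differ by its cost, and the smaller optimum then
has one ghost edge fewer. -/
theorem ghostAt_ae_eq {h : ℝ} (hh : 0 < h) (hk : k ≤ n) (d : ℕ) :
    ghostAt (k + 1) m (d + 1) (0 : Fin (n + 1)) =ᵐ[costLaw m (n + 1) h]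
      (smallEvent (k + 1) 0 m d ∩ {c | minCost (k + 1) c =
        minCost k (fun e : Edge m n => c (relabel Fin.succ e)) + c (none, 0)} : Set _) := by
  classical
  filter_upwards [ae_injective_cost hh] with c hc
  refine propext ?_
  change c ∈ ghostAt (k + 1) m (d + 1) (0 : Fin (n + 1)) ↔ c ∈ smallEvent (k + 1) 0 m d ∧
    minCost (k + 1) c = minCost k (fun e : Edge m n => c (relabel Fin.succ e)) + c (none, 0)
  have hcount : ∀ M' : Finset (Edge m (n + 1)), IsFeasible (k + 1) {0} M' →
      ghostCount (insert (none, 0) M') = ghostCount M' + 1 := by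
    intro M' hM'
    have := hM'.insert_ghost.2
    rw [ghostCount, Finset.filter_insert, if_pos rfl, Finset.card_insert_of_notMem
      (fun h => this (Finset.mem_filter.1 h).1), ghostCount]
  obtain ⟨M', hM'⟩ := exists_isBest (c := c)
    (exists_isFeasible (m := m) (n := n + 1) (k := k + 1) (Z := {0}) (by simp) (by omega))
  constructor
  · rintro ⟨M, hM, hd, h0⟩
    have h1 := hM'.2 _ (hM.1.erase h0)
    have h2 := hM.2 _ hM'.1.insert_ghost.1
    rw [cost_insert hM'.1.insert_ghost.2] at h2
    rw [cost_erase h0] at h1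
    have heq : M = insert (none, 0) M' := hc (by
      rw [cost_insert hM'.1.insert_ghost.2]
      linarith)
    refine ⟨⟨M', hM', ?_⟩, ?_⟩
    · rw [heq, hcount _ hM'.1] at hd
      omega
    · rw [hM.minCost_eq, hM'.minCost_relabel]
      linarith
  · rintro ⟨⟨N', hN', hd⟩, hmin⟩
    obtain rfl := hM'.unique hc hN'
    rw [hM'.minCost_relabel] at hmin
    obtain ⟨M, hM⟩ := exists_isBest (c := c)
      (exists_isFeasible (m := m) (n := n + 1) (k := k + 1) (Z := ∅) (by simp) (by omega))
    rw [hM.minCost_eq] at hmin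
    refine ⟨_, hM.of_cost_le hM'.1.insert_ghost.1 ?_, ?_, Finset.mem_insert_self _ _⟩
    · rw [cost_insert hM'.1.insert_ghost.2]
      linarith
    · rw [hcount _ hM'.1, hd]

theorem measurePreserving_relabel_succ {h : ℝ} (hh : 0 < h) :
    MeasurePreserving (fun (c : Edge m (n + 1) → ℝ) (e : Edge m n) => c (relabel Fin.succ e))
      (costLaw m (n + 1) h) (costLaw m n h) :=
  have := isProbabilityMeasure_rate (m := m) (n := n + 1) hh
  measurePreserving_comp (fun e : Edge m (n + 1) => expMeasure (rate h e))
    (relabel_injective (Fin.succ_injective n))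

/-- Integration by parts in the cost of the ghost edge at the additional vertex. -/
theorem setIntegral_smallEvent {h : ℝ} (hh : 0 < h) (hkm : k + 1 ≤ m) (hk : k ≤ n) (d : ℕ) (t : ℂ)
    (h1 : IntegrableOn (expCost (k + 1) t) (smallEvent (k + 1) 0 m d) (costLaw m (n + 1) h))
    (h2 : IntegrableOn (expCost k t) (ghostEvent k m n d) (costLaw m n h))
    (h3 : IntegrableOn (expCost (k + 1) t) (ghostAt (k + 1) m (d + 1) (0 : Fin (n + 1)))
      (costLaw m (n + 1) h)) :
    ∫ c in smallEvent (k + 1) 0 m d, expCost (k + 1) t c ∂costLaw m (n + 1) h =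
      ∫ c in ghostEvent k m n d, expCost k t c ∂costLaw m n h +
        t / h * ∫ c in ghostAt (k + 1) m (d + 1) (0 : Fin (n + 1)), expCost (k + 1) t c
          ∂costLaw m (n + 1) h := by
  classical
  have hk' : k + 1 ≤ n + 1 := by omega
  have := isProbabilityMeasure_rate (m := m) (n := n + 1) hh
  have := isProbabilityMeasure_costLaw (m := m) (n := n + 1) hh
  have hres := measurePreserving_relabel_succ (m := m) (n := n) hh
  set S := smallEvent (k + 1) (0 : Fin (n + 1)) m d with hS
  have hSm : MeasurableSet S := measurableSet_smallEvent _ _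
  set r : (Edge m (n + 1) → ℝ) → (Edge m n → ℝ) := fun c e => c (relabel Fin.succ e) with hr
  set U : Set (Edge m (n + 1) → ℝ) :=
    {c | minCost (k + 1) c = minCost k (r c) + c (none, 0)} with hU
  have hUm : MeasurableSet U := measurableSet_eq_fun (measurable_minCost hk')
    (((measurable_minCost hk).comp hres.measurable).add (measurable_pi_apply _))
  have hSr : S = r ⁻¹' ghostEvent k m n d := by
    ext c
    exact mem_smallEvent_iff
  have hae : ghostAt (k + 1) m (d + 1) (0 : Fin (n + 1)) =ᵐ[costLaw m (n + 1) h] (S ∩ U : Set _) :=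
    ghostAt_ae_eq hh hk d
  rw [setIntegral_congr_set hae]
  have h3' := h3.congr_set_ae hae.symm
  have h2' : IntegrableOn (fun c => expCost k t (r c)) S (costLaw m (n + 1) h) := by
    have := (hres.integrable_comp_of_integrable
      ((integrable_indicator_iff (measurableSet_ghostEvent d)).2 h2))
    rw [← integrable_indicator_iff hSm, hSr]
    exact this
  have e2 : ∫ c in ghostEvent k m n d, expCost k t c ∂costLaw m n h =
      ∫ c in S, expCost k t (r c) ∂costLaw m (n + 1) h := by
    rw [← hres.map_eq, setIntegral_map (measurableSet_ghostEvent d)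
      (measurable_expCost hk t).aestronglyMeasurable hres.measurable.aemeasurable, hSr]
  rw [e2, ← integral_indicator hSm, ← integral_indicator hSm,
    ← integral_indicator (hSm.inter hUm), ← sub_eq_zero, ← integral_const_mul, ← sub_sub]
  replace h1 := h1.integrable_indicator hSm
  replace h2' := h2'.integrable_indicator hSm
  replace h3' := (h3'.integrable_indicator (hSm.inter hUm)).const_mul (t / h)
  have h12 : Integrable (fun c => S.indicator (expCost (k + 1) t) c -
    S.indicator (fun c => expCost k t (r c)) c) (costLaw m (n + 1) h) := h1.sub h2'
  rw [← integral_sub h1 h2', ← integral_sub h12 h3']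
  have hH := h12.sub h3'
  -- The three integrands are combined before Fubini: with the other costs fixed, the combination
  -- has mean zero in the cost of the ghost edge at `0`.
  set H : (Edge m (n + 1) → ℝ) → ℂ := fun c => S.indicator (expCost (k + 1) t) c -
    S.indicator (fun c => expCost k t (r c)) c -
    t / h * (S ∩ U).indicator (expCost (k + 1) t) c with hHdef
  change Integrable H _ at hH
  change ∫ c, H c ∂costLaw m (n + 1) h = 0
  have hp := measurePreserving_update (fun e : Edge m (n + 1) => expMeasure (rate h e)) (none, 0)
  change MeasurePreserving _ ((costLaw m (n + 1) h).prod _) (costLaw m (n + 1) h) at hp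
  have hHp : Integrable (fun p : (Edge m (n + 1) → ℝ) × ℝ => H (Function.update p.1 (none, 0) p.2))
      ((costLaw m (n + 1) h).prod (expMeasure (rate h ((none, 0) : Edge m (n + 1))))) :=
    hp.integrable_comp_of_integrable hH
  have hHm : AEStronglyMeasurable H ((((costLaw m (n + 1) h).prod
      (expMeasure (rate h ((none, 0) : Edge m (n + 1)))))).map
      fun p => Function.update p.1 (none, 0) p.2) := by
    rw [hp.map_eq]
    exact hH.aestronglyMeasurable
  rw [← hp.map_eq, integral_map hp.measurable.aemeasurable hHm, integral_prod _ hHp]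
  refine integral_eq_zero_of_ae ?_
  filter_upwards [ae_nonneg_costLaw hh] with c hc
  have hrate : rate h ((none, 0) : Edge m (n + 1)) = h := if_pos rfl
  rw [hrate]
  -- The smaller graph does not see the resampled coordinate, so `S` and the cost of `M'` are
  -- constant along it, and `U` becomes `x ≤ T`.
  have hru : ∀ x, r (Function.update c (none, 0) x) = r c := by
    intro x
    funext e
    simp only [hr]
    rw [Function.update_of_ne]
    simp only [relabel, ne_eq, Prod.mk.injEq, not_and]
    exact fun _ => Fin.succ_ne_zero _
  have hSu : ∀ x, Function.update c (none, 0) x ∈ S ↔ c ∈ S := by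
    intro x
    rw [hSr, Set.mem_preimage, Set.mem_preimage, hru]
  obtain ⟨M', hM'⟩ := exists_isBest (c := c)
    (exists_isFeasible (m := m) (n := n + 1) (k := k + 1) (Z := {0}) (by simp) (by omega))
  obtain ⟨T, hT, hmin⟩ := exists_threshold (by omega) hkm hk' 0 hc hM'
  rw [← hM'.minCost_relabel] at hmin
  by_cases hcS : c ∈ S
  · have hHx : ∀ x, H (Function.update c (none, 0) x) = expCost k t (r c) *
        (Complex.exp (t * (min x T : ℝ)) - 1 -
          t / h * (if x ≤ T then Complex.exp (t * x) else 0)) := by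
      intro x
      have hcU : Function.update c (none, 0) x ∈ U ↔ x ≤ T := by
        rw [hU, Set.mem_ofPred_eq, hmin, hru, Function.update_self, add_right_inj, min_eq_left_iff]
      have hsplit : expCost (k + 1) t (Function.update c (none, 0) x) =
          expCost k t (r c) * Complex.exp (t * (min x T : ℝ)) := by
        rw [expCost, expCost, hmin, ← Complex.exp_add, ← mul_add]
        push_cast
        rfl
      simp only [hHdef, Set.indicator, Set.mem_inter_iff, hSu, hcS, true_and, if_true, hcU, hru,
        hsplit]
      split_ifs with hx
      · rw [min_eq_left hx]
        ring
      · ring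
    change ∫ x, H (Function.update c (none, 0) x) ∂expMeasure h = 0
    simp_rw [hHx]
    rw [integral_const_mul, integral_exp_min_expMeasure hh hT, mul_zero]
  · refine integral_eq_zero_of_ae (ae_of_all _ fun x => ?_)
    simp [hHdef, Set.indicator, hSu, hcS]

/-- The integrals `X` and `Y` over the joint events `(d, d)` and `(d, d+1)` satisfy `h X = (m-k+d)
Y`, where `k+1` is the size of the larger matching, and `X + Y` is known from the integration by
parts; this is solved for both. Integrability over `(d, d)` is inherited from `(d, d+1)`, so only
the larger graph with `d+1` ghost edges is assumed integrable. -/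
theorem setIntegral_joint_of_integrable {h : ℝ} (hh : 0 < h) (hkm : k + 1 ≤ m) (hk : k ≤ n) (d : ℕ)
    (t : ℂ) (h0 : Integrable (ghostVariable k m n d t) (costLaw m n h))
    (h1 : Integrable (ghostVariable (k + 1) m (n + 1) (d + 1) t) (costLaw m (n + 1) h)) :
    IntegrableOn (expCost (k + 1) t) (jointEvent (k + 1) (0 : Fin (n + 1)) m d d Set.univ)
        (costLaw m (n + 1) h) ∧
      IntegrableOn (expCost (k + 1) t) (jointEvent (k + 1) (0 : Fin (n + 1)) m d (d + 1) Set.univ)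
        (costLaw m (n + 1) h) ∧
      (m - k + d + h : ℂ) * ∫ c in jointEvent (k + 1) (0 : Fin (n + 1)) m d d Set.univ,
          expCost (k + 1) t c ∂costLaw m (n + 1) h =
        (m - k + d : ℂ) * (∫ c, ghostVariable k m n d t c ∂costLaw m n h + t / h *
          ((d + 1) / (n + 1) * ∫ c, ghostVariable (k + 1) m (n + 1) (d + 1) t c
            ∂costLaw m (n + 1) h)) ∧
      (m - k + d + h : ℂ) * ∫ c in jointEvent (k + 1) (0 : Fin (n + 1)) m d (d + 1) Set.univ,
          expCost (k + 1) t c ∂costLaw m (n + 1) h =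
        h * (∫ c, ghostVariable k m n d t c ∂costLaw m n h + t / h *
          ((d + 1) / (n + 1) * ∫ c, ghostVariable (k + 1) m (n + 1) (d + 1) t c
            ∂costLaw m (n + 1) h)) := by
  have hk' : k + 1 ≤ n + 1 := by omega
  rw [integrable_ghostVariable_iff] at h0 h1
  have hY : IntegrableOn (expCost (k + 1) t)
      (jointEvent (k + 1) (0 : Fin (n + 1)) m d (d + 1) Set.univ) (costLaw m (n + 1) h) := by
    refine h1.mono_set ?_
    rintro c ⟨M', M, -, hM, -, hd, -⟩
    exact mem_ghostEvent.2 ⟨M, hM, hd⟩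
  have hX := (integrableOn_jointEvent_iff hh hk' hkm 0 d t).2 hY
  refine ⟨hX, hY, ?_⟩
  have hXY := setIntegral_jointEvent hh hk' hkm 0 d t
  have hsmall := smallEvent_ae_eq (m := m) hh hk' (0 : Fin (n + 1)) d
  have hA : ∫ c in smallEvent (k + 1) 0 m d, expCost (k + 1) t c ∂costLaw m (n + 1) h =
      ∫ c in jointEvent (k + 1) (0 : Fin (n + 1)) m d d Set.univ,
          expCost (k + 1) t c ∂costLaw m (n + 1) h +
        ∫ c in jointEvent (k + 1) (0 : Fin (n + 1)) m d (d + 1) Set.univ,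
          expCost (k + 1) t c ∂costLaw m (n + 1) h := by
    rw [setIntegral_congr_set hsmall]
    exact setIntegral_union₀ (aedisjoint_jointEvent hh 0 (by simp))
      (measurableSet_jointEvent _ _ _ MeasurableSet.univ).nullMeasurableSet hX hY
  have hS := setIntegral_smallEvent hh hkm hk d t ((hX.union hY).congr_set_ae hsmall) h0
    (h1.mono_set (ghostAt_subset _ _))
  have hG := setIntegral_ghostAt hh hk' (d + 1) t 0 h1
  rw [integral_ghostVariable, integral_ghostVariable]
  push_cast at hXY hG
  have hn : (n + 1 : ℂ) ≠ 0 := by exact_mod_cast Nat.succ_ne_zero n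
  rw [hA, eq_div_of_mul_eq hn ((mul_comm _ _).trans hG)] at hS
  rw [div_mul_eq_mul_div (d + 1 : ℂ) (n + 1), ← hS]
  constructor
  · linear_combination hXY
  · linear_combination -hXY

/-! ### The exact recursions for positive `h`. -/

section Quotient

variable {h : ℝ} (hh : 0 < h) (hkm : k + 1 ≤ m) (hk : k ≤ n) (t : ℂ)
include hh hkm

theorem coeff_ne_zero (d : ℕ) : (m - k + d + h : ℂ) ≠ 0 := by
  have h1 : (k : ℝ) + 1 ≤ m := by exact_mod_cast hkm
  have h2 : (0 : ℝ) < m - k + d + h := by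
    have : (0 : ℝ) ≤ d := d.cast_nonneg
    linarith
  exact_mod_cast h2.ne'

include hk

/-- The recursion for `d = 0` before passing to the limit. -/
theorem ghostQuotient_zero
    (h0 : Integrable (ghostVariable k m n 0 t) (costLaw m n h))
    (h1 : Integrable (ghostVariable (k + 1) m (n + 1) 1 t) (costLaw m (n + 1) h)) :
    ghostQuotient (k + 1) m (n + 1) 0 t h = (m - k : ℂ) / (m - k + h) *
      (ghostQuotient k m n 0 t h + t / (n + 1) * ghostQuotient (k + 1) m (n + 1) 1 t h) := by
  obtain ⟨-, -, hX, -⟩ := setIntegral_joint_of_integrable hh hkm hk 0 t h0 h1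
  have hne := coeff_ne_zero hh hkm 0
  simp only [ghostQuotient]
  rw [integral_ghostVariable (k := k + 1) (n := n + 1) 0,
    setIntegral_congr_set (ghostEvent_zero_ae_eq hh (by omega) 0 (by omega)),
    eq_div_of_mul_eq hne ((mul_comm _ _).trans hX)]
  have hh' : (h : ℂ) ≠ 0 := by exact_mod_cast hh.ne'
  have hn : (n + 1 : ℂ) ≠ 0 := by exact_mod_cast Nat.succ_ne_zero n
  simp only [Nat.cast_zero, add_zero, zero_add, pow_zero, pow_one] at hne ⊢
  field_simp

/-- The recursion for `d ≥ 1` before passing to the limit. -/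
theorem ghostQuotient_succ (d : ℕ)
    (h0 : Integrable (ghostVariable k m n d t) (costLaw m n h))
    (h0' : Integrable (ghostVariable k m n (d + 1) t) (costLaw m n h))
    (h1 : Integrable (ghostVariable (k + 1) m (n + 1) (d + 1) t) (costLaw m (n + 1) h))
    (h2 : Integrable (ghostVariable (k + 1) m (n + 1) (d + 2) t) (costLaw m (n + 1) h)) :
    ghostQuotient (k + 1) m (n + 1) (d + 1) t h =
      (m - k + d + 1 : ℂ) / (m - k + d + 1 + h) * (ghostQuotient k m n (d + 1) t h +
          t * (d + 2) / (n + 1) * ghostQuotient (k + 1) m (n + 1) (d + 2) t h) +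
        1 / (m - k + d + h) * (ghostQuotient k m n d t h +
          t * (d + 1) / (n + 1) * ghostQuotient (k + 1) m (n + 1) (d + 1) t h) := by
  obtain ⟨-, iY, -, hY⟩ := setIntegral_joint_of_integrable hh hkm hk d t h0 h1
  obtain ⟨iX, -, hX, -⟩ := setIntegral_joint_of_integrable hh hkm hk (d + 1) t h0' h2
  have hne := coeff_ne_zero hh hkm d
  have hne' := coeff_ne_zero hh hkm (d + 1)
  have hsum := (integral_ghostVariable (k := k + 1) (m := m) (n := n + 1) (d + 1) t h).trans
    ((setIntegral_congr_set (ghostEvent_succ_ae_eq hh (by omega) 0 d (by omega))).trans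
      (setIntegral_union₀ (aedisjoint_jointEvent hh 0 (by simp))
        (measurableSet_jointEvent _ _ _ MeasurableSet.univ).nullMeasurableSet iX iY))
  rw [eq_div_of_mul_eq hne ((mul_comm _ _).trans hY),
    eq_div_of_mul_eq hne' ((mul_comm _ _).trans hX)] at hsum
  -- Only the left side is expanded: the expectation for `d + 1` ghost edges also stands on the
  -- right, where the integration by parts has produced it.
  conv_lhs => rw [ghostQuotient, hsum]
  simp only [ghostQuotient]
  have hh' : (h : ℂ) ≠ 0 := by exact_mod_cast hh.ne'
  have hn : (n + 1 : ℂ) ≠ 0 := by exact_mod_cast Nat.succ_ne_zero n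
  push_cast at hne' ⊢
  rw [← add_assoc] at hne'
  generalize ∫ c, ghostVariable k m n d t c ∂costLaw m n h = a
  generalize ∫ c, ghostVariable k m n (d + 1) t c ∂costLaw m n h = b
  generalize ∫ c, ghostVariable (k + 1) m (n + 1) (d + 1) t c ∂costLaw m (n + 1) h = x
  generalize ∫ c, ghostVariable (k + 1) m (n + 1) (d + 2) t c ∂costLaw m (n + 1) h = y
  rw [← add_assoc]
  generalize hu : (m - k + d + h : ℂ) = u at *
  generalize hv : (m - k + d + 1 + h : ℂ) = v at *
  generalize (m - k + d + 1 : ℂ) = w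
  have e1 : (h : ℂ) ^ (d + 2) = h ^ d * h * h := by ring
  have e2 : (h : ℂ) ^ (d + 1) = h ^ d * h := by ring
  rw [e1, e2]
  field_simp
  ring

end Quotient

/-! ### The limit of the recursions as `h` tends to `0`. -/

theorem Converges.tendsto {d : ℕ} {t : ℂ} (H : Converges k m n d t) :
    Tendsto (ghostQuotient k m n d t) (𝓝[>] 0) (𝓝 (ghostGF k m n d t)) :=
  tendsto_nhds_limUnder H.2

theorem tendsto_ofReal_nhdsGT_zero : Tendsto (fun h : ℝ => (h : ℂ)) (𝓝[>] 0) (𝓝 0) := by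
  have := (Complex.continuous_ofReal.tendsto 0).mono_left (nhdsWithin_le_nhds (s := Set.Ioi 0))
  simpa using this

theorem limit_coeff_ne_zero (hkm : k + 1 ≤ m) (d : ℕ) : (m - k + d : ℂ) ≠ 0 := by
  have h1 : (k : ℝ) + 1 ≤ m := by exact_mod_cast hkm
  have h2 : (0 : ℝ) < m - k + d := by
    have : (0 : ℝ) ≤ d := d.cast_nonneg
    linarith
  exact_mod_cast h2.ne'

theorem tendsto_ratio (hkm : k + 1 ≤ m) (d : ℕ) :
    Tendsto (fun h : ℝ => (m - k + d : ℂ) / (m - k + d + h)) (𝓝[>] 0) (𝓝 1) := by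
  have hne := limit_coeff_ne_zero hkm d
  have h1 : Tendsto (fun h : ℝ => (m - k + d + h : ℂ)) (𝓝[>] 0) (𝓝 (m - k + d + 0)) :=
    tendsto_const_nhds.add tendsto_ofReal_nhdsGT_zero
  rw [add_zero] at h1
  have h2 := (tendsto_const_nhds (x := (m - k + d : ℂ))).div h1 hne
  rw [div_self hne] at h2
  exact h2

theorem tendsto_inv (hkm : k + 1 ≤ m) (d : ℕ) :
    Tendsto (fun h : ℝ => 1 / (m - k + d + h : ℂ)) (𝓝[>] 0) (𝓝 (1 / (m - k + d))) := by
  have hne := limit_coeff_ne_zero hkm d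
  have h1 : Tendsto (fun h : ℝ => (m - k + d + h : ℂ)) (𝓝[>] 0) (𝓝 (m - k + d + 0)) :=
    tendsto_const_nhds.add tendsto_ofReal_nhdsGT_zero
  rw [add_zero] at h1
  exact tendsto_const_nhds.div h1 hne

theorem ghostGF_zero_eq (hkm : k + 1 ≤ m) (hk : k ≤ n) {t : ℂ}
    (h0 : Converges (k + 1) m (n + 1) 0 t) (h1 : Converges (k + 1) m (n + 1) 1 t)
    (h2 : Converges k m n 0 t) :
    ghostGF (k + 1) m (n + 1) 0 t =
      t / (n + 1) * ghostGF (k + 1) m (n + 1) 1 t + ghostGF k m n 0 t := by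
  have hr := tendsto_ratio hkm 0
  simp only [Nat.cast_zero, add_zero] at hr
  have hlim := hr.mul (h2.tendsto.add (h1.tendsto.const_mul (t / (n + 1))))
  rw [one_mul, add_comm (ghostGF k m n 0 t)] at hlim
  refine tendsto_nhds_unique h0.tendsto (hlim.congr' ?_)
  filter_upwards [h1.1, h2.1, self_mem_nhdsWithin] with h i1 i2 hh
  exact (ghostQuotient_zero hh hkm hk t i2 i1).symm

theorem ghostGF_succ_eq (hkm : k + 1 ≤ m) (hk : k ≤ n) {d : ℕ} {t : ℂ}
    (h1 : Converges (k + 1) m (n + 1) (d + 1) t) (h2 : Converges (k + 1) m (n + 1) (d + 2) t)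
    (h0 : Converges k m n d t) (h0' : Converges k m n (d + 1) t) :
    ghostGF (k + 1) m (n + 1) (d + 1) t = (ghostGF k m n (d + 1) t +
        t * (d + 2) / (n + 1) * ghostGF (k + 1) m (n + 1) (d + 2) t) +
      1 / (m - k + d) * (ghostGF k m n d t +
        t * (d + 1) / (n + 1) * ghostGF (k + 1) m (n + 1) (d + 1) t) := by
  have hr := tendsto_ratio hkm (d + 1)
  push_cast at hr
  rw [← add_assoc] at hr
  have hlim := (hr.mul (h0'.tendsto.add (h2.tendsto.const_mul (t * (d + 2) / (n + 1))))).add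
    ((tendsto_inv hkm d).mul (h0.tendsto.add (h1.tendsto.const_mul (t * (d + 1) / (n + 1)))))
  rw [one_mul] at hlim
  refine tendsto_nhds_unique h1.tendsto (hlim.congr' ?_)
  filter_upwards [h0.1, h0'.1, h1.1, h2.1, self_mem_nhdsWithin] with h i0 i0' i1 i2 hh
  exact (ghostQuotient_succ hh hkm hk t d i0 i0' i1 i2).symm

/-! ### Impossible ghost counts and the empty matching. -/

theorem ghostVariable_eq_zero {d : ℕ} (hd : k < d) (t : ℂ) : ghostVariable k m n d t = 0 := by
  have : ghostEvent k m n d = ∅ := by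
    rw [Set.eq_empty_iff_forall_notMem]
    rintro c ⟨M, hM, hc⟩
    have h1 : ghostCount M ≤ M.card := Finset.card_filter_le _ _
    rw [hM.1.2] at h1
    omega
  rw [ghostVariable, this, Set.indicator_empty]
  rfl

theorem tendsto_ghostQuotient_of_lt {d : ℕ} (hd : k < d) (t : ℂ) :
    Tendsto (ghostQuotient k m n d t) (𝓝[>] 0) (𝓝 0) := by
  have : ghostQuotient k m n d t = fun _ => 0 := by
    funext h
    simp [ghostQuotient, ghostVariable_eq_zero hd]
  rw [this]
  exact tendsto_const_nhds

theorem converges_of_lt {d : ℕ} (hd : k < d) (t : ℂ) :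
    Converges k m n d t ∧ ghostGF k m n d t = 0 := by
  refine ⟨⟨Eventually.of_forall fun h => ?_, 0, tendsto_ghostQuotient_of_lt hd t⟩,
    (tendsto_ghostQuotient_of_lt hd t).limUnder_eq⟩
  rw [ghostVariable_eq_zero hd]
  exact integrable_zero _ _ _

theorem ghostVariable_zero_zero (t : ℂ) : ghostVariable 0 m n 0 t = fun _ => 1 := by
  have hk : ∀ M : Finset (Edge m n), IsKMatching 0 M ↔ M = ∅ := fun M => by
    simp only [IsKMatching, Finset.card_eq_zero]
    constructor
    · exact fun h => h.2
    · rintro rfl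
      simp [IsMatching]
  have hbest : ∀ c : Edge m n → ℝ, IsBest 0 ∅ c ∅ := fun c =>
    isBest_empty_iff.2 ⟨(hk _).2 rfl, fun M hM => by rw [(hk M).1 hM]⟩
  funext c
  rw [ghostVariable, Set.indicator_of_mem (mem_ghostEvent.2 ⟨∅, hbest c, by simp [ghostCount]⟩),
    (hbest c).minCost_eq]
  simp [cost]

theorem converges_zero_zero (t : ℂ) :
    Converges 0 m n 0 t ∧ ghostGF 0 m n 0 t = 1 := by
  have hlim : Tendsto (ghostQuotient 0 m n 0 t) (𝓝[>] 0) (𝓝 1) := by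
    refine tendsto_const_nhds.congr' ?_
    filter_upwards [self_mem_nhdsWithin] with h hh
    have := isProbabilityMeasure_costLaw (m := m) (n := n) hh
    simp [ghostQuotient, ghostVariable_zero_zero]
  refine ⟨⟨?_, 1, hlim⟩, hlim.limUnder_eq⟩
  filter_upwards [self_mem_nhdsWithin] with h hh
  have := isProbabilityMeasure_costLaw (m := m) (n := n) hh
  rw [ghostVariable_zero_zero]
  exact integrable_const _

/-! ### Convergence in the closed left half-plane. -/

theorem minCost_nonneg {c : Edge m n → ℝ} (hc : ∀ e, 0 ≤ c e) : 0 ≤ minCost k c := by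
  refine Real.sInf_nonneg ?_
  rintro _ ⟨M, -, rfl⟩
  exact Finset.sum_nonneg fun e _ => hc e

theorem integrable_ghostVariable {h : ℝ} (hh : 0 < h) (hk : k ≤ n) (d : ℕ) {t : ℂ}
    (ht : t.re ≤ 0) : Integrable (ghostVariable k m n d t) (costLaw m n h) := by
  have := isProbabilityMeasure_costLaw (m := m) (n := n) hh
  refine Integrable.mono' (integrable_const (1 : ℝ))
    ((measurable_expCost hk t).indicator (measurableSet_ghostEvent d)).aestronglyMeasurable ?_
  filter_upwards [ae_nonneg_costLaw hh] with c hc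
  refine (norm_indicator_le_norm_self _ _).trans ?_
  rw [Complex.norm_exp, Real.exp_le_one_iff]
  simpa using mul_nonpos_of_nonpos_of_nonneg ht (minCost_nonneg hc)

theorem one_le_re_of_re_nonpos {t : ℂ} (ht : t.re ≤ 0) {x : ℝ} (hx : 0 ≤ x) :
    1 ≤ (1 - t * x : ℂ).re := by
  simp only [Complex.sub_re, Complex.one_re, Complex.mul_re, Complex.ofReal_re, Complex.ofReal_im]
  nlinarith [mul_nonneg (neg_nonneg.2 ht) hx]

theorem ne_zero_of_one_le_re {z : ℂ} (hz : 1 ≤ z.re) : z ≠ 0 := by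
  rintro rfl
  norm_num at hz

/-- The induction is on `k` and, for given `k`, downwards in the number of ghost edges, starting
where this exceeds `k` and all terms vanish. Solving the exact recursion for the unknown term
divides by a number that has real part at least `1` for `Re t ≤ 0`, uniformly in `h`. -/
theorem exists_tendsto_ghostQuotient {t : ℂ} (ht : t.re ≤ 0) (hkm : k ≤ m) :
    ∀ (n : ℕ), k ≤ n → ∀ d, ∃ z, Tendsto (ghostQuotient k m n d t) (𝓝[>] 0) (𝓝 z) := by
  induction k with
  | zero =>
    intro n _ d
    rcases Nat.eq_zero_or_pos d with rfl | hd
    · exact (converges_zero_zero t).1.2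
    · exact ⟨0, tendsto_ghostQuotient_of_lt hd t⟩
  | succ k ih =>
    intro n hn
    obtain ⟨n, rfl⟩ : ∃ n', n = n' + 1 := ⟨n - 1, by omega⟩
    have hk : k ≤ n := by omega
    have ih := ih (by omega) n hk
    -- For `j = 0` the number `d` exceeds the matching size `k + 1`; each increase of `j` admits one
    -- smaller `d`.
    suffices H : ∀ j d, k + 2 ≤ d + j → ∃ z,
        Tendsto (ghostQuotient (k + 1) m (n + 1) d t) (𝓝[>] 0) (𝓝 z) from
      fun d => H (k + 2) d (by omega)
    intro j
    induction j with
    | zero => exact fun d hd => ⟨0, tendsto_ghostQuotient_of_lt (by omega) t⟩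
    | succ j ihj =>
      intro d hd
      rcases d with _ | d
      · obtain ⟨z₁, hz₁⟩ := ihj 1 (by omega)
        obtain ⟨z₂, hz₂⟩ := ih 0
        have hr := tendsto_ratio hkm 0
        simp only [Nat.cast_zero, add_zero] at hr
        refine ⟨_, (hr.mul (hz₂.add (hz₁.const_mul (t / (n + 1))))).congr' ?_⟩
        filter_upwards [self_mem_nhdsWithin] with h hh
        exact (ghostQuotient_zero hh hkm hk t (integrable_ghostVariable hh hk _ ht)
          (integrable_ghostVariable hh (by omega) _ ht)).symm
      · obtain ⟨z₁, hz₁⟩ := ihj (d + 2) (by omega)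
        obtain ⟨z₂, hz₂⟩ := ih d
        obtain ⟨z₃, hz₃⟩ := ih (d + 1)
        have hr := tendsto_ratio hkm (d + 1)
        push_cast at hr
        rw [← add_assoc] at hr
        have hnum := (hr.mul (hz₃.add (hz₁.const_mul (t * (d + 2) / (n + 1))))).add
          ((tendsto_inv hkm d).mul hz₂)
        have hden : Tendsto (fun h : ℝ => 1 - t * (d + 1) / (n + 1) * (1 / (m - k + d + h : ℂ)))
            (𝓝[>] 0) (𝓝 (1 - t * (d + 1) / (n + 1) * (1 / (m - k + d)))) :=
          tendsto_const_nhds.sub ((tendsto_inv hkm d).const_mul _)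
        have hkm' : (k : ℝ) + 1 ≤ m := by exact_mod_cast hkm
        have hne : ∀ h : ℝ, 0 ≤ h →
            (1 - t * (d + 1) / (n + 1) * (1 / (m - k + d + h)) : ℂ) ≠ 0 := by
          intro h hh
          have h0 : (0 : ℝ) ≤ (d + 1) / (n + 1) * (1 / (m - k + d + h)) := by
            have : (0 : ℝ) ≤ d := d.cast_nonneg
            have : (0 : ℝ) ≤ m - k + d + h := by linarith
            positivity
          refine ne_zero_of_one_le_re (le_of_le_of_eq (one_le_re_of_re_nonpos ht h0)
            (congrArg Complex.re ?_))
          push_cast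
          ring
        refine ⟨_, (hnum.div hden (by simpa using hne 0 le_rfl)).congr' ?_⟩
        filter_upwards [self_mem_nhdsWithin] with h hh
        have key := ghostQuotient_succ hh hkm hk t d (integrable_ghostVariable hh hk _ ht)
          (integrable_ghostVariable hh hk _ ht) (integrable_ghostVariable hh (by omega) _ ht)
          (integrable_ghostVariable hh (by omega) _ ht)
        simp only [Pi.div_apply]
        rw [div_eq_iff (hne h (le_of_lt hh))]
        linear_combination -key

theorem converges_of_re_nonpos {t : ℂ} (ht : t.re ≤ 0) (hkm : k ≤ m) (hk : k ≤ n) (d : ℕ) :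
    Converges k m n d t :=
  ⟨by
    filter_upwards [self_mem_nhdsWithin] with h hh
    exact integrable_ghostVariable hh hk d ht, exists_tendsto_ghostQuotient ht hkm n hk d⟩

/-! ### Positivity on the real axis, and the coefficient in the recursion. -/

theorem ghostQuotient_ofReal (d : ℕ) (τ h : ℝ) : ghostQuotient k m n d τ h =
    ((1 / h ^ d * ∫ c, (ghostEvent k m n d).indicator (fun c => Real.exp (τ * minCost k c)) c
      ∂costLaw m n h : ℝ) : ℂ) := by
  have : ghostVariable k m n d τ = fun c => (((ghostEvent k m n d).indicator
      (fun c => Real.exp (τ * minCost k c)) c : ℝ) : ℂ) := by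
    funext c
    simp only [ghostVariable, Set.indicator]
    split_ifs <;> simp
  rw [ghostQuotient, this, integral_complex_ofReal]
  push_cast
  rfl

theorem Converges.tendsto_re {d : ℕ} {t : ℂ} (H : Converges k m n d t) :
    Tendsto (fun h => (ghostQuotient k m n d t h).re) (𝓝[>] 0) (𝓝 (ghostGF k m n d t).re) :=
  (Complex.continuous_re.tendsto _).comp H.tendsto

theorem ghostGF_re_nonneg {d : ℕ} {τ : ℝ} (H : Converges k m n d τ) :
    0 ≤ (ghostGF k m n d τ).re := by
  refine ge_of_tendsto H.tendsto_re ?_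
  filter_upwards [self_mem_nhdsWithin] with h hh
  rw [ghostQuotient_ofReal, Complex.ofReal_re]
  have hh : 0 < h := hh
  have : 0 ≤ ∫ c, (ghostEvent k m n d).indicator (fun c => Real.exp (τ * minCost k c)) c
      ∂costLaw m n h :=
    integral_nonneg fun c => Set.indicator_nonneg (fun _ _ => (Real.exp_pos _).le) c
  positivity

theorem integrable_indicator_exp {d : ℕ} {τ h : ℝ}
    (H : Integrable (ghostVariable k m n d τ) (costLaw m n h)) :
    Integrable ((ghostEvent k m n d).indicator fun c => Real.exp (τ * minCost k c))
      (costLaw m n h) := by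
  refine H.re.congr (ae_of_all _ fun c => ?_)
  simp only [ghostVariable, Set.indicator]
  split_ifs
  · change (Complex.exp (τ * minCost k c)).re = _
    rw [← Complex.ofReal_mul, ← Complex.ofReal_exp, Complex.ofReal_re]
  · simp

theorem ghostGF_re_mono {d : ℕ} {σ τ : ℝ} (hστ : σ ≤ τ) (H : Converges k m n d σ)
    (H' : Converges k m n d τ) : (ghostGF k m n d σ).re ≤ (ghostGF k m n d τ).re := by
  refine le_of_tendsto_of_tendsto H.tendsto_re H'.tendsto_re ?_
  filter_upwards [self_mem_nhdsWithin, H.1, H'.1] with h hh i i'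
  have hh : 0 < h := hh
  rw [ghostQuotient_ofReal, ghostQuotient_ofReal, Complex.ofReal_re, Complex.ofReal_re]
  refine mul_le_mul_of_nonneg_left (integral_mono_ae (integrable_indicator_exp i)
    (integrable_indicator_exp i') ?_) (by positivity)
  filter_upwards [ae_nonneg_costLaw hh] with c hc
  refine Set.indicator_le_indicator (Real.exp_le_exp.2 ?_)
  exact mul_le_mul_of_nonneg_right hστ (minCost_nonneg hc)

/-- At `t = 0` only the terms of the smaller graph survive in the recursion. The one with a ghost
edge fewer, or for `d = 0` the one without ghost edges, is positive by induction. -/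
theorem ghostGF_re_pos_of_zero (hkm : k ≤ m) :
    ∀ n : ℕ, k ≤ n → ∀ d ≤ k, 0 < (ghostGF k m n d (0 : ℝ)).re := by
  induction k with
  | zero =>
    intro n _ d hd
    obtain rfl : d = 0 := by omega
    rw [(converges_zero_zero _).2]
    simp
  | succ k ih =>
    intro n hn d hd
    obtain ⟨n, rfl⟩ : ∃ n', n = n' + 1 := ⟨n - 1, by omega⟩
    have hk : k ≤ n := by omega
    have ih := ih (by omega) n hk
    have hre : ((0 : ℝ) : ℂ).re ≤ 0 := by simp
    have C : ∀ d, Converges k m n d ((0 : ℝ) : ℂ) := converges_of_re_nonpos hre (by omega) hk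
    have C' : ∀ d, Converges (k + 1) m (n + 1) d ((0 : ℝ) : ℂ) :=
      converges_of_re_nonpos hre hkm (by omega)
    rcases d with _ | d
    · rw [ghostGF_zero_eq hkm hk (C' 0) (C' 1) (C 0)]
      simpa using ih 0 (by omega)
    · rw [ghostGF_succ_eq hkm hk (C' _) (C' _) (C d) (C (d + 1))]
      have hkm' : (k : ℝ) + 1 ≤ m := by exact_mod_cast hkm
      have hpos : (0 : ℝ) < m - k + d := by
        have : (0 : ℝ) ≤ d := d.cast_nonneg
        linarith
      have hc : (1 / (m - k + d) : ℂ) = ((1 / (m - k + d) : ℝ) : ℂ) := by push_cast; rfl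
      rw [hc]
      simp only [Complex.ofReal_zero, zero_mul, zero_div, add_zero, Complex.add_re,
        Complex.re_ofReal_mul]
      have h1 := ghostGF_re_nonneg (C (d + 1))
      have h2 := ih d (by omega)
      have h3 : (0 : ℝ) < 1 / (m - k + d) := by positivity
      rw [Complex.ofReal_zero] at h1 h2
      nlinarith [mul_pos h3 h2]

/-- A zero of the coefficient can only lie at a positive real `t`. There the unknown term cancels
from the recursion, leaving a vanishing sum of nonnegative terms. But the term of the smaller graph
with `d` ghost edges is at least its value at `0`, by monotonicity, and that value is positive since
`d ≤ k`. -/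
theorem coeff_ne_zero_of_converges (hkm : k + 1 ≤ m) (hk : k ≤ n) {d : ℕ} (hd : d ≤ k) {t : ℂ}
    (h1 : Converges (k + 1) m (n + 1) (d + 1) t) (h2 : Converges (k + 1) m (n + 1) (d + 2) t)
    (h0 : Converges k m n d t) (h0' : Converges k m n (d + 1) t) :
    (1 - (d + 1) * t / ((m - k + d) * (n + 1)) : ℂ) ≠ 0 := by
  intro hzero
  have hkm' : (k : ℝ) + 1 ≤ m := by exact_mod_cast hkm
  have hpos : (0 : ℝ) < m - k + d := by
    have : (0 : ℝ) ≤ d := d.cast_nonneg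
    linarith
  have hne := limit_coeff_ne_zero hkm d
  have hn : (n + 1 : ℂ) ≠ 0 := by exact_mod_cast Nat.succ_ne_zero n
  have hd1 : (d + 1 : ℂ) ≠ 0 := by exact_mod_cast Nat.succ_ne_zero d
  set τ : ℝ := (m - k + d) * (n + 1) / (d + 1) with hτ
  have hτpos : 0 < τ := by positivity
  have ht : t = (τ : ℂ) := by
    rw [hτ]
    push_cast
    rw [eq_div_iff hd1]
    rw [sub_eq_zero, eq_div_iff (mul_ne_zero hne hn)] at hzero
    linear_combination -hzero
  have key := ghostGF_succ_eq hkm hk h1 h2 h0 h0'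
  subst ht
  have hcoef : (1 / (m - k + d) * ((τ : ℂ) * (d + 1) / (n + 1)) : ℂ) = 1 := by
    rw [sub_eq_zero, eq_div_iff (mul_ne_zero hne hn)] at hzero
    field_simp
    linear_combination -hzero
  have hsum : ghostGF k m n (d + 1) τ + ((τ * (d + 2) / (n + 1) : ℝ) : ℂ) *
      ghostGF (k + 1) m (n + 1) (d + 2) τ + ((1 / (m - k + d) : ℝ) : ℂ) * ghostGF k m n d τ = 0 := by
    push_cast
    linear_combination -key - ghostGF (k + 1) m (n + 1) (d + 1) τ * hcoef
  have hre := congrArg Complex.re hsum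
  simp only [Complex.add_re, Complex.re_ofReal_mul, Complex.zero_re] at hre
  have p1 := ghostGF_re_nonneg h0'
  have p2 := ghostGF_re_nonneg h2
  have hre0 : ((0 : ℝ) : ℂ).re ≤ 0 := by simp
  have p3 := (ghostGF_re_pos_of_zero (by omega) n hk d hd).trans_le
    (ghostGF_re_mono hτpos.le (converges_of_re_nonpos hre0 (by omega : k ≤ m) hk d) h0)
  have p4 : 0 < 1 / (m - k + d : ℝ) * (ghostGF k m n d τ).re := by positivity
  have p5 : 0 ≤ τ * (d + 2) / (n + 1) * (ghostGF (k + 1) m (n + 1) (d + 2) τ).re := by positivity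
  linarith

end GhostMatching

theorem theoremT :
    -- convergence in the closed left half-plane
    (∀ (k m n d : ℕ) (t : ℂ), k ≤ m → k ≤ n → t.re ≤ 0 →
      GhostMatching.Converges k m n d t) ∧
    -- base case
    (∀ (m n : ℕ) (t : ℂ),
      GhostMatching.Converges 0 m n 0 t ∧ GhostMatching.ghostGF 0 m n 0 t = 1) ∧
    -- impossible terms are zero
    (∀ (k m n d : ℕ) (t : ℂ), k ≤ m → k ≤ n → k < d →
      GhostMatching.Converges k m n d t ∧ GhostMatching.ghostGF k m n d t = 0) ∧
    -- the recursion for `d = 0`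
    (∀ (k m n : ℕ) (t : ℂ), 1 ≤ k → k ≤ m → k ≤ n →
      GhostMatching.Converges k m n 0 t →
      GhostMatching.Converges k m n 1 t →
      GhostMatching.Converges (k - 1) m (n - 1) 0 t →
      GhostMatching.ghostGF k m n 0 t =
        t / (n : ℂ) * GhostMatching.ghostGF k m n 1 t +
          GhostMatching.ghostGF (k - 1) m (n - 1) 0 t) ∧
    -- the recursion for `d ≥ 1`
    (∀ (k m n d : ℕ) (t : ℂ), 1 ≤ k → k ≤ m → k ≤ n → 1 ≤ d →
      GhostMatching.Converges k m n d t →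
      GhostMatching.Converges k m n (d + 1) t →
      GhostMatching.Converges (k - 1) m (n - 1) (d - 1) t →
      GhostMatching.Converges (k - 1) m (n - 1) d t →
      (d ≤ k → 1 - (d : ℂ) * t / (((m : ℂ) - (k : ℂ) + (d : ℂ)) * (n : ℂ)) ≠ 0) ∧
      GhostMatching.ghostGF k m n d t =
        (1 - (d : ℂ) * t / (((m : ℂ) - (k : ℂ) + (d : ℂ)) * (n : ℂ)))⁻¹ *
          (1 / ((m : ℂ) - (k : ℂ) + (d : ℂ)) *
              GhostMatching.ghostGF (k - 1) m (n - 1) (d - 1) t +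
            ((d : ℂ) + 1) / (n : ℂ) * t * GhostMatching.ghostGF k m n (d + 1) t +
            GhostMatching.ghostGF (k - 1) m (n - 1) d t)) := by

  refine ⟨fun k m n d t hkm hkn ht => GhostMatching.converges_of_re_nonpos ht hkm hkn d,
    fun m n t => GhostMatching.converges_zero_zero t,
    fun k m n d t _ _ hd => GhostMatching.converges_of_lt hd t, ?_, ?_⟩
  · intro k m n t hk hkm hkn h0 h1 h2
    obtain ⟨k, rfl⟩ : ∃ k', k = k' + 1 := ⟨k - 1, by omega⟩
    obtain ⟨n, rfl⟩ : ∃ n', n = n' + 1 := ⟨n - 1, by omega⟩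
    have := GhostMatching.ghostGF_zero_eq hkm (by omega) h0 h1 h2
    simpa using this
  · intro k m n d t hk hkm hkn hd h1 h2 h0 h0'
    obtain ⟨k, rfl⟩ : ∃ k', k = k' + 1 := ⟨k - 1, by omega⟩
    obtain ⟨n, rfl⟩ : ∃ n', n = n' + 1 := ⟨n - 1, by omega⟩
    obtain ⟨d, rfl⟩ : ∃ d', d = d' + 1 := ⟨d - 1, by omega⟩
    simp only [Nat.add_sub_cancel] at h0 h0' ⊢
    -- Both `k` and `d` have been shifted by one, which leaves `m - k + d` unchanged.
    have hcast : (m : ℂ) - ((k + 1 : ℕ) : ℂ) + ((d + 1 : ℕ) : ℂ) = m - k + d := by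
      push_cast
      ring
    rw [hcast]
    push_cast
    have hkn' : k ≤ n := by omega
    by_cases hdk : d ≤ k
    · have hne := GhostMatching.coeff_ne_zero_of_converges hkm hkn' hdk h1 h2 h0 h0'
      refine ⟨fun _ => hne, ?_⟩
      rw [eq_inv_mul_iff_mul_eq₀ hne]
      have key := GhostMatching.ghostGF_succ_eq hkm hkn' h1 h2 h0 h0'
      have hm := GhostMatching.limit_coeff_ne_zero hkm d
      have hn : (n + 1 : ℂ) ≠ 0 := by exact_mod_cast Nat.succ_ne_zero n
      have e : ((d + 1) * t / ((m - k + d) * (n + 1)) : ℂ) =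
          1 / (m - k + d) * (t * (d + 1) / (n + 1)) := by
        field_simp
      rw [e]
      linear_combination key
    · refine ⟨fun h => absurd h (by omega), ?_⟩
      rw [(GhostMatching.converges_of_lt (by omega) t).2,
        (GhostMatching.converges_of_lt (by omega) t).2,
        (GhostMatching.converges_of_lt (by omega) t).2,
        (GhostMatching.converges_of_lt (by omega) t).2]
      simp
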